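/- **Conventions.** A *Banach analytic manifold* is a connected Hausdorff topological space in which each point has a neighbourhood homeomorphic to an open subset of a complex Banach space, with holomorphic transition maps. For Banach analytic manifolds $A$ and $X$, $\mathrm{Hol}(A,X)$ is the space of holomorphic maps $A\to X$ with the compact-open topology. For a sequence $\{f_k\}\subset \mathrm{Hol}(A,X)$ let $Z_{\{f_k\}}$ be the set of $\lambda\in A$ such that $\{f_k(\lambda)\}$ converges in $X$. For $S\subset A$ let $S^u$ be the set of all $z\in\overline S$ such that for every connected open neighbourhood $U$ of $z$, each holomorphic $f:U\to\mathbb C$ vanishing on $U\cap S$ vanishes identically on $U$; write $Z^u_{\{f_k\}}:=(Z_{\{f_k\}})^u$. $X$ has the *weak Vitali property* (WVP) if for every Banach analytic manifold $A$, every sequence $\{f_k\}\subset\mathrm{Hol}(A,X)$ with $Z_{\{f_k\}}\cap Z^u_{\{f_k\}}\neq\emptyset$ converges in $\mathrm{Hol}(A,X)$. Let $\Delta$ be the open unit disc of $\mathbb C$ with the Poincaré distance $\rho_\Delta(a,b)=\tanh^{-1}\left|\frac{a-b}{1-\bar a b}\right|$. The Kobayashi pseudo-distance $\kappa_X(p,q)$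 is the infimum of $\sum_{i=1}^n\rho_\Delta(a_i,b_i)$ over all chains consisting of points $p=p_0,p_1,\dots,p_n=q$ of $X$, points $a_i,b_i\in\Delta$ and $f_i\in\mathrm{Hol}(\Delta,X)$ with $f_i(a_i)=p_{i-1}$ and $f_i(b_i)=p_i$. $X$ is *hyperbolic* if $\kappa_X$ is a distance and defines the topology of $X$. A sequence $\{f_k\}\subset\mathrm{Hol}(A,X)$ is *compactly divergent* on an open set $\Omega\subset A$ if for all compact sets $K\subset\Omega$ and $L\subset X$ there is $k_0$ such that $f_k(K)\cap L=\emptyset$ for all $k\ge k_0$. **Theorem 3.10.** Let $X$ be a Banach analytic manifold. Then the following statements are equivalent: (i) $X$ has WVP. (ii) $X$ is hyperbolic, and for every separable Banach analytic manifold $A$, every sequence $\{f_k\}\subset\mathrm{Hol}(A,X)$ has a subsequence which either converges in $\mathrm{Hol}(A,X)$ or is compactly divergent on some open dense subset of $A$. -/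

import Mathlib

universe u v a b

open Set Filter
open scoped Manifold ContDiff Topology ENNReal

noncomputable section

namespace BanachVitali

/-! A Banach analytic manifold is a connected Hausdorff space `X` with an atlas of charts onto open
subsets of a complex Banach space `E` whose transition maps are analytic, in binders:
`[NormedAddCommGroup E] [NormedSpace ℂ E] [CompleteSpace E] [TopologicalSpace X] [T2Space X]
[ConnectedSpace X] [ChartedSpace E X] [IsManifold 𝓘(ℂ, E) ω X]`.
(By connectedness, all charts may be taken in one model space.) A map is holomorphic if it is
complex (Fréchet) differentiable in charts, i.e. `MDifferentiable 𝓘(ℂ, E) 𝓘(ℂ, F)`. -/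

/-- The space of holomorphic maps from `A` (modelled on `E`) to `X` (modelled on `F`). As a subtype
of `C(A, X)` it carries the compact-open topology. -/
abbrev Hol (E : Type*) [NormedAddCommGroup E] [NormedSpace ℂ E]
    (A : Type*) [TopologicalSpace A] [ChartedSpace E A]
    (F : Type*) [NormedAddCommGroup F] [NormedSpace ℂ F]
    (X : Type*) [TopologicalSpace X] [ChartedSpace F X] : Type _ :=
  {f : C(A, X) // MDifferentiable 𝓘(ℂ, E) 𝓘(ℂ, F) f}

/-- The set of points at which the sequence `f` converges. -/
def convergenceSet {A X : Type*} [TopologicalSpace X] (f : ℕ → A → X) : Set A :=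
  {p | ∃ x : X, Tendsto (fun k => f k p) atTop (𝓝 x)}

/-- The set `Sᵘ` of the points `z` in the closure of `S` such that, on each connected open
neighbourhood `U` of `z`, a holomorphic function that vanishes on `U ∩ S` vanishes identically. -/
def uniquenessPoints (E : Type*) [NormedAddCommGroup E] [NormedSpace ℂ E]
    {A : Type*} [TopologicalSpace A] [ChartedSpace E A] (S : Set A) : Set A :=
  {z | z ∈ closure S ∧
    ∀ U : Set A, IsOpen U → IsConnected U → z ∈ U →
      ∀ g : A → ℂ, MDifferentiableOn 𝓘(ℂ, E) 𝓘(ℂ, ℂ) g U →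
        (∀ p ∈ U ∩ S, g p = 0) → ∀ p ∈ U, g p = 0}

/-- The weak Vitali property of `X` (modelled on `F`): for every Banach analytic manifold `A`, a
sequence in `Hol(A, X)` whose set `Z` of points of convergence meets `Zᵘ` converges in
`Hol(A, X)`. -/
def WVP (F : Type v) [NormedAddCommGroup F] [NormedSpace ℂ F]
    (X : Type u) [TopologicalSpace X] [ChartedSpace F X] : Prop :=
  ∀ (E : Type b) [NormedAddCommGroup E] [NormedSpace ℂ E] [CompleteSpace E]
    (A : Type a) [TopologicalSpace A] [T2Space A] [ConnectedSpace A]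
    [ChartedSpace E A] [IsManifold 𝓘(ℂ, E) ω A] (f : ℕ → Hol E A F X),
    (convergenceSet (fun k => (f k).1) ∩
      uniquenessPoints E (convergenceSet (fun k => (f k).1))).Nonempty →
    ∃ g : Hol E A F X, Tendsto f atTop (𝓝 g)

/-- The Poincaré distance on the unit disc of `ℂ`. -/
def poincareDist (z w : ℂ) : ℝ :=
  Real.artanh ‖(z - w) / (1 - (starRingEnd ℂ) z * w)‖

/-- A holomorphic chain of discs in `X` from `p` to `q`. -/
structure HolChain (F : Type*) [NormedAddCommGroup F] [NormedSpace ℂ F]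
    {X : Type*} [TopologicalSpace X] [ChartedSpace F X] (p q : X) where
  /-- the number of discs -/
  n : ℕ
  /-- the successive points of the chain -/
  pt : ℕ → X
  /-- the initial point in the `i`-th disc -/
  a : ℕ → ℂ
  /-- the final point in the `i`-th disc -/
  b : ℕ → ℂ
  /-- the `i`-th holomorphic disc; only its values on the open unit disc matter -/
  f : ℕ → ℂ → X
  pt_zero : pt 0 = p
  pt_last : pt n = q
  a_mem : ∀ i < n, a i ∈ Metric.ball (0 : ℂ) 1
  b_mem : ∀ i < n, b i ∈ Metric.ball (0 : ℂ) 1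
  holo : ∀ i < n, MDifferentiableOn 𝓘(ℂ, ℂ) 𝓘(ℂ, F) (f i) (Metric.ball (0 : ℂ) 1)
  map_a : ∀ i < n, f i (a i) = pt i
  map_b : ∀ i < n, f i (b i) = pt (i + 1)

/-- The length of a chain: the sum of the Poincaré distances of the pairs of points. -/
def HolChain.length {F : Type*} [NormedAddCommGroup F] [NormedSpace ℂ F]
    {X : Type*} [TopologicalSpace X] [ChartedSpace F X] {p q : X} (c : HolChain F p q) : ℝ≥0∞ :=
  ∑ i ∈ Finset.range c.n, ENNReal.ofReal (poincareDist (c.a i) (c.b i))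

/-- The Kobayashi pseudo-distance of `X` (modelled on `F`). -/
def kobayashi (F : Type*) [NormedAddCommGroup F] [NormedSpace ℂ F]
    {X : Type*} [TopologicalSpace X] [ChartedSpace F X] (p q : X) : ℝ≥0∞ :=
  ⨅ c : HolChain F p q, c.length

/-- `X` is hyperbolic: the Kobayashi pseudo-distance is a distance (it is finite and separates
points; symmetry and the triangle inequality always hold) and it defines the topology of `X`. -/
def Hyperbolic (F : Type*) [NormedAddCommGroup F] [NormedSpace ℂ F]
    (X : Type*) [TopologicalSpace X] [ChartedSpace F X] : Prop :=
  (∀ p q : X, kobayashi F p q ≠ ⊤) ∧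
  (∀ p q : X, kobayashi F p q = 0 → p = q) ∧
  ∀ S : Set X, IsOpen S ↔ ∀ p ∈ S, ∃ ε : ℝ≥0∞, 0 < ε ∧ ∀ q : X, kobayashi F p q < ε → q ∈ S

/-- The sequence `f` is compactly divergent on `W`: for all compact sets `K ⊆ W` and `L ⊆ X`, the
sets `f k '' K` and `L` are disjoint for all large `k`. -/
def CompactlyDivergentOn {A X : Type*} [TopologicalSpace A] [TopologicalSpace X]
    (f : ℕ → A → X) (W : Set A) : Prop :=
  ∀ K : Set A, K ⊆ W → IsCompact K → ∀ L : Set X, IsCompact L →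
    ∃ k₀ : ℕ, ∀ k ≥ k₀, (f k '' K) ∩ L = ∅

end BanachVitali

end

/-!
# The weak Vitali property and hyperbolicity

The link between the two sides is *disc-equicontinuity* of `X`: holomorphic discs whose centres are
close to a point `x` map a fixed small disc close to `x`. It is equivalent to hyperbolicity
(`hyperbolic_iff_discEquicontinuous`): one direction is the triangle inequality for the Kobayashi
pseudo-distance, the other bounds, by the Schwarz lemma in a chart, the displacement along a short
chain of discs. Discs through nearby points of a manifold `A` turn it into local equicontinuity of
all holomorphic maps `A → X` (`DiscEquicontinuous.exists_nhds`).

*From the weak Vitali property.* If discs `f n` violated disc-equicontinuity at `x`, the maps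
`y ↦ f n (y n)` on the unit ball of `ℓ²` would converge to `x` on a dense set, but not uniformly on
a suitable null sequence of multiples of the basis vectors (`WVP.exists_disc_mem`). For the
alternative, a diagonal argument along a countable π-base of `A` gives a subsequence such that every
member of the π-base either contains a point of convergence or contains no point at which a further
subsequence converges. If the points of convergence are dense in some open set, the weak Vitali
property applies; otherwise the members of the second kind have a dense union, and equicontinuity
yields compact divergence on it. Only separability of `A` is used, so `A` need not be second
countable.

*To the weak Vitali property.* At a point of `Z ∩ Zᵘ`, equicontinuity reduces the problem to a
bounded sequence of holomorphic maps between balls of Banach spaces. Modulo the closed subspace of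
convergent sequences, the induced holomorphic map into the space of bounded sequences vanishes on a
uniqueness set, hence identically, so that `Z` is a neighbourhood of the point
(`DiscEquicontinuous.convergenceSet_mem_nhds`). The interior of `Z` is closed, because a point of
its closure is joined to it by a disc, on which the alternative and the identity theorem force
convergence of the whole sequence. By connectedness `Z = A`, and pointwise convergence improves to
convergence in `Hol(A, X)` by equicontinuity.
-/

noncomputable section

namespace BanachVitali

open Metric BoundedContinuousFunction

/-! ### Bounded sequences of holomorphic maps on a ball of a Banach space -/

section BanachSpaces

variable {E : Type*} [NormedAddCommGroup E] [NormedSpace ℂ E]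
  {F : Type*} [NormedAddCommGroup F] [NormedSpace ℂ F]

theorem norm_fderiv_le_of_norm_le {f : E → F} {c : E} {r M : ℝ} (hr : 0 < r)
    (hd : DifferentiableOn ℂ f (ball c r)) (hb : ∀ x ∈ ball c r, ‖f x‖ ≤ M) :
    ‖fderiv ℂ f c‖ ≤ 2 * M / r := by
  refine Complex.norm_fderiv_le_div_of_mapsTo_ball hd (fun x hx => ?_) hr
  rw [mem_closedBall, dist_eq_norm]
  linarith [norm_sub_le (f x) (f c), hb x hx, hb c (mem_ball_self hr)]

/-- The second-order Taylor estimate for a bounded holomorphic map: its constant depends on the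
bound and the radius only, so that it is uniform over a bounded family. -/
theorem norm_sub_sub_fderiv_le {f : E → F} {c w : E} {r M : ℝ} (hr : 0 < r)
    (hd : DifferentiableOn ℂ f (ball c r)) (hb : ∀ x ∈ ball c r, ‖f x‖ ≤ M) (hw : w ∈ ball c r) :
    ‖f w - f c - fderiv ℂ f c (w - c)‖ ≤ 4 * M / r ^ 2 * ‖w - c‖ ^ 2 := by
  have hcd : DifferentiableAt ℂ f c := hd.differentiableAt (ball_mem_nhds c hr)
  set h : E → F := fun x => f x - fderiv ℂ f c (x - c) with hh
  have hM : 0 ≤ M := (norm_nonneg _).trans (hb c (mem_ball_self hr))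
  have hhd : DifferentiableOn ℂ h (ball c r) := by
    refine hd.sub (Differentiable.differentiableOn ?_)
    fun_prop
  have h0 : h c = f c := by simp [hh]
  have key := Complex.dist_le_mul_div_pow_of_mapsTo_ball_of_isLittleO (n := 1) (R₂ := 4 * M) hhd
    (fun x hx => ?_) ?_ hw
  · rw [dist_eq_norm, h0, dist_eq_norm] at key
    calc _ = ‖h w - f c‖ := by rw [hh, sub_right_comm]
      _ ≤ _ := key
      _ = _ := by ring
  · rw [mem_closedBall, dist_eq_norm, h0]
    have h1 : ‖fderiv ℂ f c (x - c)‖ ≤ 2 * M := by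
      refine ((fderiv ℂ f c).le_opNorm _).trans ?_
      have hx' : ‖x - c‖ ≤ r := by rw [← dist_eq_norm]; exact (mem_ball.1 hx).le
      calc _ ≤ 2 * M / r * r := by
            gcongr
            exact norm_fderiv_le_of_norm_le hr hd hb
        _ = _ := by field_simp
    calc ‖h x - f c‖ = ‖f x - fderiv ℂ f c (x - c) - f c‖ := rfl
      _ ≤ ‖f x‖ + ‖fderiv ℂ f c (x - c)‖ + ‖f c‖ :=
        (norm_sub_le _ _).trans (by gcongr; exact norm_sub_le _ _)
      _ ≤ 4 * M := by linarith [hb x hx, hb c (mem_ball_self hr)]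
  · have := hcd.hasFDerivAt.isLittleO
    simp only [pow_one]
    refine (this.norm_right).congr_left fun x => ?_
    simp only [hh, sub_self, map_zero, sub_zero]
    abel

/-- A bounded sequence of holomorphic maps, viewed as a map into the space of bounded sequences,
is holomorphic, with the sequence of the derivatives as its derivative. -/
theorem exists_hasFDerivAt_boundedSeq {h : ℕ → E → F} {c : E} {r M : ℝ}
    (hd : ∀ k, DifferentiableOn ℂ (h k) (ball c r)) (hb : ∀ k, ∀ x ∈ ball c r, ‖h k x‖ ≤ M) :
    ∃ G : E → ℕ →ᵇ F, (∀ x ∈ ball c r, ∀ k, G x k = h k x) ∧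
      ∀ x ∈ ball c r, ∃ G' : E →L[ℂ] ℕ →ᵇ F, HasFDerivAt G G' x ∧
        ∀ v k, G' v k = fderiv ℂ (h k) x v := by
  classical
  let G : E → ℕ →ᵇ F := fun x => if hx : ∀ k, ‖h k x‖ ≤ M then
    ofNormedAddCommGroupDiscrete (fun k => h k x) M hx else 0
  have hG : ∀ x ∈ ball c r, ∀ k, G x k = h k x := fun x hx k => by
    have : ∀ k, ‖h k x‖ ≤ M := fun k => hb k x hx
    simp [G, this]
  refine ⟨G, hG, fun x hx => ?_⟩
  obtain ⟨ρ, hρ, hsub⟩ := Metric.isOpen_iff.1 isOpen_ball x hx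
  have hd' := fun k => (hd k).mono hsub
  have hb' := fun k y hy => hb k y (hsub hy)
  have hM : 0 ≤ M := (norm_nonneg _).trans (hb 0 x hx)
  have hL : ∀ v k, ‖fderiv ℂ (h k) x v‖ ≤ 2 * M / ρ * ‖v‖ := fun v k =>
    (fderiv ℂ (h k) x).le_of_opNorm_le (norm_fderiv_le_of_norm_le hρ (hd' k) (hb' k)) v
  let L : E →ₗ[ℂ] ℕ →ᵇ F :=
    { toFun := fun v => ofNormedAddCommGroupDiscrete (fun k => fderiv ℂ (h k) x v) _ (hL v)
      map_add' := fun v w => by ext k; simp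
      map_smul' := fun a v => by ext k; simp }
  let G' : E →L[ℂ] ℕ →ᵇ F := L.mkContinuous (2 * M / ρ) fun v =>
    (BoundedContinuousFunction.norm_le (by positivity)).2 (hL v)
  refine ⟨G', .of_isLittleO ?_, fun v k => rfl⟩
  have hO : (fun w => G w - G x - G' (w - x)) =O[𝓝 x] fun w => ‖w - x‖ ^ 2 := by
    refine Asymptotics.IsBigO.of_bound (4 * M / ρ ^ 2) ?_
    filter_upwards [ball_mem_nhds x hρ] with w hw
    rw [norm_pow, norm_norm]
    refine (BoundedContinuousFunction.norm_le (by positivity)).2 fun k => ?_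
    have := norm_sub_sub_fderiv_le hρ (hd' k) (hb' k) hw
    simpa [hG w (hsub hw), hG x hx, G', L] using this
  refine hO.trans_isLittleO ?_
  have := Asymptotics.isLittleO_norm_pow_id (E' := E) one_lt_two
  exact this.comp_tendsto (tendsto_sub_nhds_zero_iff.2 tendsto_id)

/-- The subspace of the convergent sequences in the space of bounded sequences. -/
def convergentSeq (F : Type*) [NormedAddCommGroup F] [NormedSpace ℂ F] :
    Submodule ℂ (ℕ →ᵇ F) where
  carrier := {u | ∃ y, Tendsto u atTop (𝓝 y)}
  add_mem' := by
    rintro u v ⟨y, hy⟩ ⟨z, hz⟩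
    exact ⟨y + z, hy.add hz⟩
  zero_mem' := ⟨0, tendsto_const_nhds⟩
  smul_mem' := by
    rintro a u ⟨y, hy⟩
    exact ⟨a • y, hy.const_smul a⟩

instance isClosed_convergentSeq [CompleteSpace F] :
    IsClosed (convergentSeq F : Set (ℕ →ᵇ F)) := by
  refine isClosed_of_closure_subset fun u hu => ?_
  refine cauchySeq_tendsto_of_complete (Metric.cauchySeq_iff'.2 fun ε hε => ?_)
  obtain ⟨v, ⟨y, hy⟩, huv⟩ := Metric.mem_closure_iff.1 hu (ε / 3) (by positivity)
  obtain ⟨N, hN⟩ := Metric.cauchySeq_iff'.1 hy.cauchySeq (ε / 3) (by positivity)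
  refine ⟨N, fun n hn => ?_⟩
  have h1 := (u.dist_coe_le_dist (g := v) n).trans_lt huv
  have h2 := (u.dist_coe_le_dist (g := v) N).trans_lt huv
  have h3 := dist_triangle4_right (u n) (u N) (v n) (v N)
  linarith [hN n hn]

/-- **Vitali's theorem for a uniqueness set.** A bounded sequence of holomorphic maps on a ball
that converges on a uniqueness set for scalar holomorphic functions converges on the ball: modulo
the convergent sequences, the associated map into the bounded sequences vanishes on that set. -/
theorem exists_tendsto_of_uniqueness [CompleteSpace F] {h : ℕ → E → F} {c : E} {r M : ℝ}
    (hd : ∀ k, DifferentiableOn ℂ (h k) (ball c r)) (hb : ∀ k, ∀ x ∈ ball c r, ‖h k x‖ ≤ M)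
    {S : Set E} (hS : ∀ g : E → ℂ, DifferentiableOn ℂ g (ball c r) →
      (∀ x ∈ ball c r, x ∈ S → g x = 0) → ∀ x ∈ ball c r, g x = 0)
    (hconv : ∀ x ∈ ball c r, x ∈ S → ∃ y, Tendsto (fun k => h k x) atTop (𝓝 y)) :
    ∀ x ∈ ball c r, ∃ y, Tendsto (fun k => h k x) atTop (𝓝 y) := by
  obtain ⟨G, hG, hG'⟩ := exists_hasFDerivAt_boundedSeq hd hb
  have hmem : ∀ x ∈ ball c r, (∃ y, Tendsto (fun k => h k x) atTop (𝓝 y)) ↔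
      G x ∈ convergentSeq F := fun x hx => by
    have : ⇑(G x) = fun k => h k x := funext (hG x hx)
    rw [← this]; rfl
  intro x hx
  rw [hmem x hx]
  by_contra hxn
  have hq : (convergentSeq F).mkQ (G x) ≠ 0 := by simpa using hxn
  obtain ⟨Λ, hΛ⟩ := SeparatingDual.exists_ne_zero (R := ℂ) hq
  let Q : (ℕ →ᵇ F) →L[ℂ] ℂ := Λ.comp (convergentSeq F).mkQL
  have hQ : ∀ u, Q u = Λ ((convergentSeq F).mkQ u) := fun u => rfl
  refine hΛ (hS (fun x => Q (G x)) (fun w hw => ?_) (fun w hw hwS => ?_) x hx)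
  · obtain ⟨G', hG', -⟩ := hG' w hw
    exact (Q.hasFDerivAt.comp w hG').differentiableAt.differentiableWithinAt
  · have : (convergentSeq F).mkQ (G w) = 0 := by
      simpa using (hmem w hw).1 (hconv w hw hwS)
    rw [hQ, this, map_zero]

/-- The pointwise limit of a bounded sequence of holomorphic maps is holomorphic. -/
theorem differentiableOn_of_tendsto [CompleteSpace F] {h : ℕ → E → F} {g : E → F} {c : E}
    {r M : ℝ} (hd : ∀ k, DifferentiableOn ℂ (h k) (ball c r))
    (hb : ∀ k, ∀ x ∈ ball c r, ‖h k x‖ ≤ M)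
    (hg : ∀ x ∈ ball c r, Tendsto (fun k => h k x) atTop (𝓝 (g x))) :
    DifferentiableOn ℂ g (ball c r) := by
  obtain ⟨G, hG, hG'⟩ := exists_hasFDerivAt_boundedSeq hd hb
  intro x hx
  obtain ⟨ρ, hρ, hsub⟩ := Metric.isOpen_iff.1 isOpen_ball x hx
  have hd' := fun k => (hd k).mono hsub
  have hb' := fun k y hy => hb k y (hsub hy)
  have hM : 0 ≤ M := (norm_nonneg _).trans (hb 0 x hx)
  obtain ⟨G', hGx, hGk⟩ := hG' x hx
  -- the derivatives converge pointwise, because the map into the bounded sequences takes its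
  -- values in the closed subspace of the convergent ones, hence so does its derivative
  have hlim : ∀ v, ∃ y, Tendsto (fun k => fderiv ℂ (h k) x v) atTop (𝓝 y) := by
    intro v
    have h0 : HasFDerivAt (fun w => (convergentSeq F).mkQL (G w)) (0 : E →L[ℂ] _) x := by
      refine (hasFDerivAt_const (0 : (ℕ →ᵇ F) ⧸ convergentSeq F) x).congr_of_eventuallyEq ?_
      filter_upwards [isOpen_ball.mem_nhds hx] with w hw
      have hw' : G w ∈ convergentSeq F := ⟨g w, by
        rw [show ⇑(G w) = fun k => h k w from funext (hG w hw)]; exact hg w hw⟩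
      simpa using hw'
    have h1 := ((convergentSeq F).mkQL.hasFDerivAt.comp x hGx).unique h0
    have h2 : (convergentSeq F).mkQL (G' v) = 0 := DFunLike.congr_fun h1 v
    have h3 : G' v ∈ convergentSeq F := by simpa using h2
    obtain ⟨y, hy⟩ := h3
    exact ⟨y, by rwa [show ⇑(G' v) = fun k => fderiv ℂ (h k) x v from funext (hGk v)] at hy⟩
  choose ℓ hℓ using hlim
  let L : E →ₗ[ℂ] F := linearMapOfTendsto ℓ (fun k => (fderiv ℂ (h k) x : E →ₗ[ℂ] F))
    (l := atTop) (tendsto_pi_nhds.2 hℓ)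
  let L' : E →L[ℂ] F := L.mkContinuous (2 * M / ρ) fun v =>
    le_of_tendsto' (hℓ v).norm fun k =>
      (fderiv ℂ (h k) x).le_of_opNorm_le (norm_fderiv_le_of_norm_le hρ (hd' k) (hb' k)) v
  have hO : (fun w => g w - g x - L' (w - x)) =O[𝓝 x] fun w => ‖w - x‖ ^ 2 := by
    refine Asymptotics.IsBigO.of_bound (4 * M / ρ ^ 2) ?_
    filter_upwards [ball_mem_nhds x hρ] with w hw
    rw [norm_pow, norm_norm]
    exact le_of_tendsto' (((hg w (hsub hw)).sub (hg x hx)).sub (hℓ (w - x))).norm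
      fun k => norm_sub_sub_fderiv_le hρ (hd' k) (hb' k) hw
  refine (HasFDerivAt.of_isLittleO (f' := L') (hO.trans_isLittleO
    ?_)).differentiableAt.differentiableWithinAt
  exact (Asymptotics.isLittleO_norm_pow_id (E' := E) one_lt_two).comp_tendsto
    (tendsto_sub_nhds_zero_iff.2 tendsto_id)

/-- The identity theorem on a ball of a Banach space, reduced to one variable along a line. -/
theorem eqOn_ball_of_eventuallyEq [CompleteSpace F] {f g : E → F} {c w : E} {r : ℝ}
    (hf : DifferentiableOn ℂ f (ball c r)) (hg : DifferentiableOn ℂ g (ball c r))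
    (hw : w ∈ ball c r) (h : f =ᶠ[𝓝 w] g) : EqOn f g (ball c r) := by
  intro x hx
  let γ : ℂ → E := fun t => w + t • (x - w)
  have hγ : Differentiable ℂ γ := by fun_prop
  have hγ0 : γ 0 = w := by simp [γ]
  have hγ1 : γ 1 = x := by simp [γ]
  let V : Set ℂ := γ ⁻¹' ball c r
  have hV : IsOpen V := isOpen_ball.preimage hγ.continuous
  have hconv : Convex ℝ V := by
    intro s hs t ht a b ha hb hab
    have : γ (a • s + b • t) = a • γ s + b • γ t := by
      simp only [γ, smul_add]
      rw [add_add_add_comm, ← add_smul, hab, one_smul, add_smul, smul_assoc, smul_assoc]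
    rw [mem_preimage, this]
    exact (convex_ball c r) hs ht ha hb hab
  have hd : DifferentiableOn ℂ (fun t => f (γ t) - g (γ t)) V :=
    (hf.comp hγ.differentiableOn fun t ht => ht).sub (hg.comp hγ.differentiableOn fun t ht => ht)
  have h0 : (fun t => f (γ t) - g (γ t)) =ᶠ[𝓝 0] 0 := by
    have : Tendsto γ (𝓝 0) (𝓝 w) := hγ0 ▸ hγ.continuous.tendsto 0
    filter_upwards [this.eventually h] with t ht
    simp [ht]
  have := (hd.analyticOnNhd hV).eqOn_zero_of_preconnected_of_eventuallyEq_zero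
    hconv.isPreconnected (z₀ := 0) (by simpa [V, hγ0] using hw) h0
    (show (1 : ℂ) ∈ V by simpa [V, hγ1] using hx)
  simpa [hγ1, sub_eq_zero] using this

end BanachSpaces

/-! ### Charts, the identity theorem and small discs in Banach manifolds -/

section Manifolds

variable {E : Type*} [NormedAddCommGroup E] {A : Type*} [TopologicalSpace A] [ChartedSpace E A]
  {F : Type*} [NormedAddCommGroup F] [NormedSpace ℂ F]
  {X : Type*} [TopologicalSpace X] [ChartedSpace F X]

theorem exists_chart_ball (z : A) {N : Set A} (hN : N ∈ 𝓝 z) :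
    ∃ r > 0, ball (chartAt E z z) r ⊆ (chartAt E z).target ∧
      ∀ w ∈ ball (chartAt E z z) r, (chartAt E z).symm w ∈ N := by
  have h1 : (chartAt E z).target ∈ 𝓝 (chartAt E z z) := chart_target_mem_nhds E z
  have h2 : (chartAt E z).symm ⁻¹' N ∈ 𝓝 (chartAt E z z) := by
    refine ((chartAt E z).continuousAt_symm (mem_chart_target E z)).preimage_mem_nhds ?_
    rwa [(chartAt E z).left_inv (mem_chart_source E z)]
  obtain ⟨r, hr, h⟩ := Metric.mem_nhds_iff.1 (inter_mem h1 h2)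
  exact ⟨r, hr, fun w hw => (h hw).1, fun w hw => (h hw).2⟩

theorem firstCountableTopology_of_chartedSpace (E A : Type*) [NormedAddCommGroup E]
    [TopologicalSpace A] [ChartedSpace E A] : FirstCountableTopology A where
  nhds_generated_countable z := by
    have h := (chartAt E z).symm.map_nhds_eq (mem_chart_target E z)
    rw [(chartAt E z).left_inv (mem_chart_source E z)] at h
    rw [← h]
    infer_instance

theorem isOpen_image_chart_symm {z : A} {B : Set E} (hB : B ⊆ (chartAt E z).target)
    (ho : IsOpen B) : IsOpen ((chartAt E z).symm '' B) :=
  (chartAt E z).symm.isOpen_image_of_subset_source ho hB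

variable [NormedSpace ℂ E]

theorem isConnected_image_chart_ball {z : A} {c : E} {r : ℝ} (hr : 0 < r)
    (hB : ball c r ⊆ (chartAt E z).target) :
    IsConnected ((chartAt E z).symm '' ball c r) :=
  (isConnected_ball hr).image _ ((chartAt E z).continuousOn_symm.mono hB)

theorem differentiableOn_charts [IsManifold 𝓘(ℂ, E) ω A] [IsManifold 𝓘(ℂ, F) ω X]
    {f : A → X} {U : Set A} (hf : MDifferentiableOn 𝓘(ℂ, E) 𝓘(ℂ, F) f U) {z : A} {x : X}
    {B : Set E} (hB : B ⊆ (chartAt E z).target) (hBU : ∀ w ∈ B, (chartAt E z).symm w ∈ U)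
    (hBx : ∀ w ∈ B, f ((chartAt E z).symm w) ∈ (chartAt F x).source) :
    DifferentiableOn ℂ (fun w => chartAt F x (f ((chartAt E z).symm w))) B := by
  rw [← mdifferentiableOn_iff_differentiableOn]
  have : IsManifold 𝓘(ℂ, E) 1 A := .of_le (n := ω) le_top
  have : IsManifold 𝓘(ℂ, F) 1 X := .of_le (n := ω) le_top
  exact (mdifferentiableOn_atlas (I := 𝓘(ℂ, F)) (chart_mem_atlas F x)).comp
    (hf.comp ((mdifferentiableOn_atlas_symm (I := 𝓘(ℂ, E)) (chart_mem_atlas E z)).mono hB) hBU)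
    hBx

/-- The identity theorem for holomorphic maps between Banach manifolds. -/
theorem eqOn_of_eqOn_open [IsManifold 𝓘(ℂ, E) ω A] [IsManifold 𝓘(ℂ, F) ω X] [CompleteSpace F]
    [T2Space X] {f g : A → X} {U V : Set A} (hU : IsOpen U) (hUc : IsPreconnected U)
    (hf : MDifferentiableOn 𝓘(ℂ, E) 𝓘(ℂ, F) f U) (hg : MDifferentiableOn 𝓘(ℂ, E) 𝓘(ℂ, F) g U)
    (hV : IsOpen V) (hVU : (U ∩ V).Nonempty) (h : EqOn f g (U ∩ V)) : EqOn f g U := by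
  set D : Set A := interior {z | f z = g z}
  have hDfg : ∀ z ∈ D, f z = g z := fun z hz => interior_subset (s := {z | f z = g z}) hz
  have hUD : U ⊆ D := by
    refine hUc.subset_of_closure_inter_subset isOpen_interior ?_ ?_
    · exact hVU.mono fun z hz =>
        ⟨hz.1, interior_maximal (s := {z | f z = g z}) h (hU.inter hV) hz⟩
    rintro z ⟨hzD, hzU⟩
    have hfz : ContinuousAt f z := hf.continuousOn.continuousAt (hU.mem_nhds hzU)
    have hgz : ContinuousAt g z := hg.continuousOn.continuousAt (hU.mem_nhds hzU)
    have hfg : f z = g z := by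
      by_contra hne
      have := (hfz.ne_iff_eventually_ne hgz).1 hne
      obtain ⟨y, hy, hyD⟩ := mem_closure_iff_nhds.1 hzD _ this
      exact hy (hDfg _ hyD)
    have hN : U ∩ (f ⁻¹' (chartAt F (f z)).source ∩ g ⁻¹' (chartAt F (f z)).source) ∈ 𝓝 z :=
      inter_mem (hU.mem_nhds hzU) (inter_mem
        (hfz.preimage_mem_nhds (chart_source_mem_nhds F _))
        (hgz.preimage_mem_nhds (by rw [← hfg]; exact chart_source_mem_nhds F _)))
    obtain ⟨r, hr, hrt, hrN⟩ := exists_chart_ball (E := E) z hN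
    have hB := isOpen_image_chart_symm hrt isOpen_ball
    have hzB : z ∈ (chartAt E z).symm '' ball (chartAt E z z) r :=
      ⟨_, mem_ball_self hr, (chartAt E z).left_inv (mem_chart_source E z)⟩
    obtain ⟨_, ⟨w, hw, rfl⟩, hyD⟩ := mem_closure_iff_nhds.1 hzD _ (hB.mem_nhds hzB)
    have hev : (fun w => chartAt F (f z) (f ((chartAt E z).symm w))) =ᶠ[𝓝 w]
        fun w => chartAt F (f z) (g ((chartAt E z).symm w)) := by
      filter_upwards [((chartAt E z).continuousAt_symm (hrt hw)).preimage_mem_nhds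
        (isOpen_interior.mem_nhds hyD)] with w' hw'
      have : f _ = g _ := hDfg _ hw'
      simp only [this]
    have heq := eqOn_ball_of_eventuallyEq
      (differentiableOn_charts hf hrt (fun w hw => (hrN w hw).1) fun w hw => (hrN w hw).2.1)
      (differentiableOn_charts hg hrt (fun w hw => (hrN w hw).1) fun w hw => (hrN w hw).2.2)
      hw hev
    refine mem_interior.2 ⟨_, ?_, hB, hzB⟩
    rintro _ ⟨w', hw', rfl⟩
    exact (chartAt F (f z)).injOn (hrN w' hw').2.1 (hrN w' hw').2.2 (heq hw')
  exact fun z hz => hDfg z (hUD hz)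

/-- Points near a given one are joined by a holomorphic disc staying in a prescribed neighbourhood,
with the parameters `0` and `s` prescribed. -/
theorem exists_disc_nhds [IsManifold 𝓘(ℂ, E) ω A] (z : A) {N : Set A} (hN : N ∈ 𝓝 z)
    {s : ℝ} (hs : 0 < s) (hs1 : s < 1) :
    ∃ U ∈ 𝓝 z, ∀ p ∈ U, ∀ q ∈ U, ∃ d : ℂ → A,
      MDifferentiableOn 𝓘(ℂ, ℂ) 𝓘(ℂ, E) d (ball 0 1) ∧ d 0 = p ∧ d s = q ∧
        ∀ t ∈ ball (0 : ℂ) 1, d t ∈ N := by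
  have : IsManifold 𝓘(ℂ, E) 1 A := .of_le (n := ω) le_top
  obtain ⟨r, hr, hrt, hrN⟩ := exists_chart_ball (E := E) z hN
  set φ := chartAt E z
  have hU : φ.source ∩ φ ⁻¹' ball (φ z) (r * s / 4) ∈ 𝓝 z :=
    inter_mem (chart_source_mem_nhds E z) ((φ.continuousAt (mem_chart_source E z)).preimage_mem_nhds
      (ball_mem_nhds _ (by positivity)))
  refine ⟨_, hU, fun p hp q hq => ⟨fun t => φ.symm (φ p + (t / s) • (φ q - φ p)), ?_, ?_, ?_, ?_⟩⟩
  rotate_left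
  · simp [φ.left_inv hp.1]
  · have : (s : ℂ) / s = 1 := div_self (by exact_mod_cast hs.ne')
    simp [this, φ.left_inv hq.1]
  all_goals
    have hmem : ∀ t ∈ ball (0 : ℂ) 1, φ p + (t / s) • (φ q - φ p) ∈ ball (φ z) r := by
      intro t ht
      have hp' := mem_ball_iff_norm.1 hp.2
      have hq' := mem_ball_iff_norm.1 hq.2
      have hpq : ‖φ q - φ p‖ ≤ r * s / 2 := by
        have := norm_sub_le_norm_sub_add_norm_sub (φ q) (φ z) (φ p)
        rw [norm_sub_rev (φ z)] at this
        linarith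
      have ht' : ‖t‖ < 1 := by simpa using ht
      have hts : ‖(t / s) • (φ q - φ p)‖ ≤ r / 2 := by
        rw [norm_smul, norm_div, Complex.norm_real, Real.norm_of_nonneg hs.le]
        calc ‖t‖ / s * ‖φ q - φ p‖ ≤ 1 / s * (r * s / 2) := by gcongr
          _ = r / 2 := by field_simp
      have hrs : r * s / 4 < r / 2 := by nlinarith
      rw [mem_ball_iff_norm, add_sub_right_comm]
      linarith [norm_add_le (φ p - φ z) ((t / s) • (φ q - φ p))]
  · exact fun t ht => hrN _ (hmem t ht)
  · refine ((mdifferentiableOn_atlas_symm (I := 𝓘(ℂ, E)) (chart_mem_atlas E z)).mono hrt).comp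
      (mdifferentiableOn_iff_differentiableOn.2 ?_) hmem
    refine Differentiable.differentiableOn ?_
    fun_prop

end Manifolds

/-! ### Equicontinuity of holomorphic maps and local Vitali theorem -/

section Equicontinuity

/-- Equicontinuity at `0` of the holomorphic discs in `X` whose centre is close to a given point. It
is equivalent to hyperbolicity, and is the form in which hyperbolicity is used. -/
def DiscEquicontinuous (F : Type*) [NormedAddCommGroup F] [NormedSpace ℂ F]
    (X : Type*) [TopologicalSpace X] [ChartedSpace F X] : Prop :=
  ∀ x : X, ∀ S ∈ 𝓝 x, ∃ T ∈ 𝓝 x, ∃ δ : ℝ, 0 < δ ∧ ∀ f : ℂ → X,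
    MDifferentiableOn 𝓘(ℂ, ℂ) 𝓘(ℂ, F) f (ball 0 1) → f 0 ∈ T →
      ∀ t ∈ ball (0 : ℂ) 1, ‖t‖ < δ → f t ∈ S

variable {F : Type*} [NormedAddCommGroup F] [NormedSpace ℂ F]
  {X : Type*} [TopologicalSpace X] [ChartedSpace F X]

theorem exists_real_ball_lt {δ : ℝ} (hδ : 0 < δ) :
    ∃ s : ℝ, 0 < s ∧ s < 1 ∧ (s : ℂ) ∈ ball (0 : ℂ) 1 ∧ ‖(s : ℂ)‖ < δ := by
  obtain ⟨s, hs, hs'⟩ := exists_between (lt_min hδ one_pos)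
  have h1 := hs'.trans_le (min_le_right _ _)
  have h2 := hs'.trans_le (min_le_left _ _)
  have h3 : ‖(s : ℂ)‖ = s := by rw [Complex.norm_real, Real.norm_of_nonneg hs.le]
  exact ⟨s, hs, h1, by rwa [mem_ball_zero_iff, h3], by rwa [h3]⟩

theorem DiscEquicontinuous.regularSpace [IsManifold 𝓘(ℂ, F) ω X] (hX : DiscEquicontinuous F X) :
    RegularSpace X := by
  refine .of_exists_mem_nhds_isClosed_subset fun x S hS => ?_
  obtain ⟨T, hT, δ, hδ, h⟩ := hX x S hS
  refine ⟨closure T, mem_of_superset hT subset_closure, isClosed_closure, fun y hy => ?_⟩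
  -- `y` lies on a small disc centred at a point of `T`
  obtain ⟨s, hs, hs1, hsb, hsδ⟩ := exists_real_ball_lt hδ
  obtain ⟨U, hU, hUd⟩ := exists_disc_nhds (E := F) y univ_mem hs hs1
  obtain ⟨p, hpU, hpT⟩ := mem_closure_iff_nhds.1 hy U hU
  obtain ⟨d, hd, hd0, hds, -⟩ := hUd p hpU y (mem_of_mem_nhds hU)
  rw [← hds]
  exact h d hd (by rwa [hd0]) s hsb hsδ

variable {E : Type*} [NormedAddCommGroup E] [NormedSpace ℂ E]
  {A : Type*} [TopologicalSpace A] [ChartedSpace E A]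

/-- Under disc-equicontinuity, all holomorphic maps into `X` are locally equicontinuous. -/
theorem DiscEquicontinuous.exists_nhds [IsManifold 𝓘(ℂ, E) ω A] (hX : DiscEquicontinuous F X)
    (z : A) (x : X) {S : Set X} (hS : S ∈ 𝓝 x) :
    ∃ T ∈ 𝓝 x, ∃ U ∈ 𝓝 z, ∀ f : A → X, MDifferentiable 𝓘(ℂ, E) 𝓘(ℂ, F) f →
      ∀ p ∈ U, ∀ q ∈ U, f p ∈ T → f q ∈ S := by
  obtain ⟨T, hT, δ, hδ, h⟩ := hX x S hS
  obtain ⟨s, hs, hs1, hsb, hsδ⟩ := exists_real_ball_lt hδ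
  obtain ⟨U, hU, hUd⟩ := exists_disc_nhds (E := E) z univ_mem hs hs1
  refine ⟨T, hT, U, hU, fun f hf p hp q hq hfp => ?_⟩
  obtain ⟨d, hd, hd0, hds, -⟩ := hUd p hp q hq
  have := h (f ∘ d) (hf.comp_mdifferentiableOn hd) (by simpa [hd0] using hfp) s hsb hsδ
  simpa [hds] using this

/-- A sequence of holomorphic maps that converges at `z` is read, near `z` and from some index on,
as a bounded sequence of maps between balls in charts. The set `S` is closed, so that pointwise
limits stay in the chart domain. -/
theorem DiscEquicontinuous.exists_local_charts [IsManifold 𝓘(ℂ, E) ω A]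
    [IsManifold 𝓘(ℂ, F) ω X] (hX : DiscEquicontinuous F X) {f : ℕ → A → X}
    (hf : ∀ k, MDifferentiable 𝓘(ℂ, E) 𝓘(ℂ, F) (f k)) {z : A} {x : X}
    (hx : Tendsto (fun k => f k z) atTop (𝓝 x)) {N : Set X} (hN : N ∈ 𝓝 x) :
    ∃ r > 0, ∃ R : ℝ, ∃ S : Set X, ∃ k₀ : ℕ, ball (chartAt E z z) r ⊆ (chartAt E z).target ∧
      IsClosed S ∧ S ⊆ (chartAt F x).source ∧ S ⊆ N ∧
      (∀ y ∈ S, chartAt F x y ∈ closedBall (chartAt F x x) R) ∧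
      closedBall (chartAt F x x) R ⊆ (chartAt F x).target ∧
      ∀ k ≥ k₀, ∀ w ∈ ball (chartAt E z z) r, f k ((chartAt E z).symm w) ∈ S := by
  have := hX.regularSpace
  obtain ⟨R, hR, hRt⟩ := Metric.nhds_basis_closedBall.mem_iff.1 (chart_target_mem_nhds F x)
  have h1 : (chartAt F x).source ∩ (chartAt F x ⁻¹' closedBall (chartAt F x x) R) ∩ N ∈ 𝓝 x :=
    inter_mem (inter_mem (chart_source_mem_nhds F x)
      (((chartAt F x).continuousAt (mem_chart_source F x)).preimage_mem_nhds
        (closedBall_mem_nhds _ hR))) hN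
  obtain ⟨S, ⟨hS, hSc⟩, hSs⟩ := (closed_nhds_basis x).mem_iff.1 h1
  obtain ⟨T, hT, U, hU, hTU⟩ := hX.exists_nhds (E := E) z x hS
  obtain ⟨r, hr, hrt, hrU⟩ := exists_chart_ball (E := E) z hU
  obtain ⟨k₀, hk₀⟩ := eventually_atTop.1 (hx.eventually_mem hT)
  exact ⟨r, hr, R, S, k₀, hrt, hSc, fun y hy => (hSs hy).1.1, fun y hy => (hSs hy).2,
    fun y hy => (hSs hy).1.2, hRt,
    fun k hk w hw => hTU (f k) (hf k) z (mem_of_mem_nhds hU) _ (hrU w hw) (hk₀ k hk)⟩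

/-- Points of convergence at which the convergence set is a uniqueness set are interior to it. -/
theorem DiscEquicontinuous.convergenceSet_mem_nhds [IsManifold 𝓘(ℂ, E) ω A]
    [IsManifold 𝓘(ℂ, F) ω X] [CompleteSpace F] (hX : DiscEquicontinuous F X) {f : ℕ → A → X}
    (hf : ∀ k, MDifferentiable 𝓘(ℂ, E) 𝓘(ℂ, F) (f k)) {z : A} (hz : z ∈ convergenceSet f)
    (hzu : z ∈ uniquenessPoints E (convergenceSet f)) : convergenceSet f ∈ 𝓝 z := by
  obtain ⟨x, hx⟩ := hz
  obtain ⟨r, hr, R, S, k₀, hrt, hSc, hSs, -, hSR, hRt, hk⟩ :=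
    hX.exists_local_charts hf hx univ_mem
  have : IsManifold 𝓘(ℂ, E) 1 A := .of_le (n := ω) le_top
  set φ := chartAt E z
  set ψ := chartAt F x
  have hB := isOpen_image_chart_symm hrt isOpen_ball
  have hzB : z ∈ φ.symm '' ball (φ z) r :=
    ⟨_, mem_ball_self hr, φ.left_inv (mem_chart_source E z)⟩
  let h : ℕ → E → F := fun k w => ψ (f (k + k₀) (φ.symm w))
  have hhS : ∀ k, ∀ w ∈ ball (φ z) r, f (k + k₀) (φ.symm w) ∈ S := fun k w hw =>
    hk _ (Nat.le_add_left _ _) w hw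
  have hhR : ∀ k, ∀ w ∈ ball (φ z) r, h k w ∈ closedBall (ψ x) R := fun k w hw =>
    hSR _ (hhS k w hw)
  have hhd : ∀ k, DifferentiableOn ℂ (h k) (ball (φ z) r) := fun k =>
    differentiableOn_charts (hf (k + k₀)).mdifferentiableOn hrt (fun w _ => mem_univ _)
      fun w hw => hSs (hhS k w hw)
  have hlim := exists_tendsto_of_uniqueness (M := ‖ψ x‖ + R) hhd
    (fun k w hw => norm_le_of_mem_closedBall (hhR k w hw)) (S := φ.symm ⁻¹' convergenceSet f)
    (fun g hg hg0 w hw => ?_) (fun w hw hwS => ?_)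
  · filter_upwards [hB.mem_nhds hzB]
    rintro _ ⟨w, hw, rfl⟩
    obtain ⟨y, hy⟩ := hlim w hw
    have hyR : y ∈ closedBall (ψ x) R :=
      isClosed_closedBall.mem_of_tendsto hy (Eventually.of_forall fun k => hhR k w hw)
    refine ⟨ψ.symm y, (tendsto_add_atTop_iff_nat k₀).1 ?_⟩
    refine ((ψ.continuousAt_symm (hRt hyR)).tendsto.comp hy).congr fun k => ?_
    exact ψ.left_inv (hSs (hhS k w hw))
  · have hgφ : MDifferentiableOn 𝓘(ℂ, E) 𝓘(ℂ, ℂ) (g ∘ φ) (φ.symm '' ball (φ z) r) := by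
      refine (mdifferentiableOn_iff_differentiableOn.2 hg).comp
        ((mdifferentiableOn_atlas (I := 𝓘(ℂ, E)) (chart_mem_atlas E z)).mono ?_) ?_
      · rintro _ ⟨w, hw, rfl⟩
        exact φ.map_target (hrt hw)
      · rintro _ ⟨w, hw, rfl⟩
        rwa [mem_preimage, φ.right_inv (hrt hw)]
    have := hzu.2 _ hB (isConnected_image_chart_ball hr hrt) hzB (g ∘ φ) hgφ ?_ (φ.symm w)
      ⟨w, hw, rfl⟩
    · simpa [φ.right_inv (hrt hw)] using this
    · rintro _ ⟨⟨w, hw, rfl⟩, hwS⟩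
      exact (congrArg g (φ.right_inv (hrt hw))).trans (hg0 w hw hwS)
  · obtain ⟨y, hy⟩ := hwS
    have hyS : y ∈ S := hSc.mem_of_tendsto hy
      (eventually_atTop.2 ⟨k₀, fun k hk' => hk k hk' w hw⟩)
    exact ⟨ψ y, (ψ.continuousAt (hSs hyS)).tendsto.comp
      ((tendsto_add_atTop_iff_nat k₀).2 hy)⟩

/-- Under disc-equicontinuity, pointwise convergence on `A` implies convergence in `Hol(A, X)`. -/
theorem DiscEquicontinuous.exists_tendsto_hol [IsManifold 𝓘(ℂ, E) ω A]
    [IsManifold 𝓘(ℂ, F) ω X] [CompleteSpace F] (hX : DiscEquicontinuous F X)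
    (f : ℕ → Hol E A F X) {g : A → X}
    (hg : ∀ z, Tendsto (fun k => (f k).1 z) atTop (𝓝 (g z))) :
    ∃ g' : Hol E A F X, Tendsto f atTop (𝓝 g') := by
  have hcont : Continuous g := by
    refine continuous_iff_continuousAt.2 fun z => tendsto_def.2 fun N hN => ?_
    obtain ⟨r, hr, R, S, k₀, hrt, hSc, -, hSN, -, -, hk⟩ :=
      hX.exists_local_charts (fun k => (f k).2) (hg z) hN
    filter_upwards [(isOpen_image_chart_symm hrt isOpen_ball).mem_nhds
      ⟨_, mem_ball_self hr, (chartAt E z).left_inv (mem_chart_source E z)⟩]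
    rintro _ ⟨w, hw, rfl⟩
    exact hSN (hSc.mem_of_tendsto (hg _) (eventually_atTop.2 ⟨k₀, fun k hk' => hk k hk' w hw⟩))
  have hhol : MDifferentiable 𝓘(ℂ, E) 𝓘(ℂ, F) g := by
    intro z
    obtain ⟨r, hr, R, S, k₀, hrt, hSc, hSs, -, hSR, -, hk⟩ :=
      hX.exists_local_charts (fun k => (f k).2) (hg z) univ_mem
    have hhS : ∀ k, ∀ w ∈ ball (chartAt E z z) r,
        (f (k + k₀)).1 ((chartAt E z).symm w) ∈ S := fun k w hw =>
      hk _ (Nat.le_add_left _ _) w hw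
    have hd := differentiableOn_of_tendsto
      (h := fun k w => chartAt F (g z) ((f (k + k₀)).1 ((chartAt E z).symm w)))
      (g := fun w => chartAt F (g z) (g ((chartAt E z).symm w))) (M := ‖chartAt F (g z) (g z)‖ + R)
      (fun k => differentiableOn_charts (f (k + k₀)).2.mdifferentiableOn hrt
        (fun w _ => mem_univ _) fun w hw => hSs (hhS k w hw))
      (fun k w hw => norm_le_of_mem_closedBall (hSR _ (hhS k w hw)))
      (fun w hw => ?_)
    · refine (mdifferentiableAt_iff _ _).2 ⟨hcont.continuousAt, ?_⟩
      simpa [writtenInExtChartAt, Function.comp_def, differentiableWithinAt_univ] using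
        hd.differentiableAt (ball_mem_nhds _ hr)
    · have hS : g ((chartAt E z).symm w) ∈ S := hSc.mem_of_tendsto (hg _)
        (eventually_atTop.2 ⟨k₀, fun k hk' => hk k hk' w hw⟩)
      exact ((chartAt F (g z)).continuousAt (hSs hS)).tendsto.comp
        ((tendsto_add_atTop_iff_nat k₀).2 (hg _))
  refine ⟨⟨⟨g, hcont⟩, hhol⟩, tendsto_subtype_rng.2 ?_⟩
  refine ContinuousMap.tendsto_nhds_compactOpen.2 fun K hK V hV hKV => ?_
  refine hK.induction_on (p := fun K => ∀ᶠ k in atTop, MapsTo (f k).1 K V) ?_ ?_ ?_ ?_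
  · simp [MapsTo]
  · exact fun s t hst h => h.mono fun k hk => hk.mono_left hst
  · exact fun s t hs ht => (hs.and ht).mono fun k hk => hk.1.union hk.2
  · intro z hz
    obtain ⟨T, hT, U, hU, hTU⟩ := hX.exists_nhds (E := E) z (g z) (hV.mem_nhds (hKV hz))
    refine ⟨U, mem_nhdsWithin_of_mem_nhds hU, ?_⟩
    filter_upwards [(hg z).eventually_mem hT] with k hk q hq
    exact hTU _ (f k).2 z (mem_of_mem_nhds hU) q hq hk

end Equicontinuity

/-! ### The Poincaré distance -/

section Poincare

open Complex ComplexConjugate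

theorem poincareDist_zero_left (w : ℂ) : poincareDist 0 w = Real.artanh ‖w‖ := by
  simp [poincareDist]

theorem le_artanh {x : ℝ} (h0 : 0 ≤ x) (h1 : x < 1) : x ≤ Real.artanh x := by
  rw [Real.artanh_eq_half_log ⟨by linarith, h1.le⟩, Real.log_div (by linarith) (by linarith)]
  have h := le_hasSum (Real.hasSum_log_sub_log_of_abs_lt_one (by rwa [abs_of_nonneg h0])) 0
    fun k _ => by positivity
  simp at h
  linarith

theorem exists_ofReal_artanh_lt {ε : ℝ≥0∞} (hε : 0 < ε) :
    ∃ δ : ℝ, 0 < δ ∧ δ < 1 ∧ ∀ x : ℝ, 0 ≤ x → x ≤ δ → ENNReal.ofReal (Real.artanh x) < ε := by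
  obtain ⟨η, -, h0, hη⟩ := ENNReal.lt_iff_exists_real_btwn.1 hε
  have hη0 : 0 < η := by simpa using h0
  have h1 := Real.tanh_lt_one η
  have h2 : 0 < Real.tanh η := by
    rw [Real.tanh_eq_sinh_div_cosh]
    exact div_pos (Real.sinh_pos_iff.2 hη0) (Real.cosh_pos η)
  refine ⟨Real.tanh η, h2, h1, fun x hx hxη => lt_of_le_of_lt ?_ hη⟩
  refine ENNReal.ofReal_le_ofReal ?_
  rw [← Real.artanh_tanh η]
  exact Real.artanh_le_artanh (by linarith) h1 hxη

theorem one_add_conj_mul_ne_zero {a t : ℂ} (ha : ‖a‖ < 1) (ht : ‖t‖ < 1) :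
    1 + conj a * t ≠ 0 := by
  intro h
  have h1 : ‖conj a * t‖ = 1 := by
    rw [eq_neg_of_add_eq_zero_right h, norm_neg, norm_one]
  rw [norm_mul, Complex.norm_conj] at h1
  nlinarith [norm_nonneg a, norm_nonneg t]

theorem norm_mobius_lt_one {a t : ℂ} (ha : ‖a‖ < 1) (ht : ‖t‖ < 1) :
    ‖(t + a) / (1 + conj a * t)‖ < 1 := by
  have h0 : 0 < ‖1 + conj a * t‖ := norm_pos_iff.2 (one_add_conj_mul_ne_zero ha ht)
  rw [norm_div, div_lt_one h0]
  refine lt_of_pow_lt_pow_left₀ 2 h0.le ?_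
  have h1 : ‖1 + conj a * t‖ ^ 2 - ‖t + a‖ ^ 2 = (1 - ‖t‖ ^ 2) * (1 - ‖a‖ ^ 2) := by
    simp only [Complex.sq_norm, Complex.normSq_apply]
    simp
    ring
  have h2 : 0 < (1 - ‖t‖ ^ 2) * (1 - ‖a‖ ^ 2) := by
    apply mul_pos <;> nlinarith [norm_nonneg a, norm_nonneg t]
  linarith

/-- The homogeneity of the Poincaré disc: two points of the disc can be moved to `0` and to a point
whose modulus is bounded by their Poincaré distance. -/
theorem exists_mobius {a b : ℂ} (ha : a ∈ ball (0 : ℂ) 1) (hb : b ∈ ball (0 : ℂ) 1) :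
    ∃ m : ℂ → ℂ, DifferentiableOn ℂ m (ball 0 1) ∧ MapsTo m (ball 0 1) (ball 0 1) ∧ m 0 = a ∧
      ∃ s ∈ ball (0 : ℂ) 1, m s = b ∧ ‖s‖ ≤ poincareDist a b := by
  rw [mem_ball_zero_iff] at ha hb
  have hab : 1 - conj a * b ≠ 0 := by
    simpa [sub_eq_add_neg] using one_add_conj_mul_ne_zero (a := -a) (by simpa using ha) hb
  have hs : ‖(b - a) / (1 - conj a * b)‖ < 1 := by
    simpa [sub_eq_add_neg] using norm_mobius_lt_one (a := -a) (by simpa using ha) hb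
  refine ⟨fun t => (t + a) / (1 + conj a * t), ?_, fun t ht => ?_, by simp,
    (b - a) / (1 - conj a * b), by simpa using hs, ?_, ?_⟩
  · refine DifferentiableOn.div (by fun_prop) (by fun_prop) fun t ht => ?_
    exact one_add_conj_mul_ne_zero ha (by simpa using ht)
  · simpa using norm_mobius_lt_one ha (by simpa using ht)
  · have h := one_add_conj_mul_ne_zero ha hs
    have hab' : 1 - b * conj a ≠ 0 := by rwa [mul_comm b]
    rw [div_eq_iff h]
    field_simp
    ring
  · have h : ‖(b - a) / (1 - conj a * b)‖ = ‖(a - b) / (1 - conj a * b)‖ := by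
      rw [norm_div, norm_div, norm_sub_rev]
    rw [h] at hs ⊢
    exact le_artanh (norm_nonneg _) hs

end Poincare

/-! ### Hyperbolicity and disc-equicontinuity -/

section Kobayashi

variable {F : Type*} [NormedAddCommGroup F] [NormedSpace ℂ F]
  {X : Type*} [TopologicalSpace X] [ChartedSpace F X]

theorem kobayashi_self (p : X) : kobayashi F p p = 0 := by
  let c : HolChain F p p :=
    { n := 0, pt := fun _ => p, a := 0, b := 0, f := fun _ _ => p
      pt_zero := rfl, pt_last := rfl
      a_mem := by simp, b_mem := by simp, holo := by simp, map_a := by simp, map_b := by simp }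
  refine le_antisymm ((iInf_le _ c).trans_eq ?_) bot_le
  simp [HolChain.length, c]

/-- A chain of discs can be prolonged by one more disc. -/
theorem kobayashi_le_add (p : X) {d : ℂ → X}
    (hd : MDifferentiableOn 𝓘(ℂ, ℂ) 𝓘(ℂ, F) d (ball 0 1)) {a b : ℂ} (ha : a ∈ ball (0 : ℂ) 1)
    (hb : b ∈ ball (0 : ℂ) 1) :
    kobayashi F p (d b) ≤ kobayashi F p (d a) + ENNReal.ofReal (poincareDist a b) := by
  rw [kobayashi, kobayashi, ENNReal.iInf_add]
  refine le_iInf fun c => ?_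
  let c' : HolChain F p (d b) :=
    { n := c.n + 1
      pt := fun i => if i ≤ c.n then c.pt i else d b
      a := fun i => if i < c.n then c.a i else a
      b := fun i => if i < c.n then c.b i else b
      f := fun i => if i < c.n then c.f i else d
      pt_zero := by simp [c.pt_zero]
      pt_last := by simp
      a_mem := fun i hi => by
        split_ifs with h
        exacts [c.a_mem i h, ha]
      b_mem := fun i hi => by
        split_ifs with h
        exacts [c.b_mem i h, hb]
      holo := fun i hi => by
        split_ifs with h
        exacts [c.holo i h, hd]
      map_a := fun i hi => by
        rcases (Nat.lt_succ_iff.1 hi).lt_or_eq with h | rfl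
        · simp [h, h.le, c.map_a i h]
        · simp [c.pt_last]
      map_b := fun i hi => by
        rcases (Nat.lt_succ_iff.1 hi).lt_or_eq with h | rfl
        · simp [h, Nat.succ_le_of_lt h, c.map_b i h]
        · simp }
  refine (iInf_le _ c').trans_eq ?_
  simp only [HolChain.length, c', Finset.sum_range_succ, lt_irrefl, if_false]
  congr 1
  refine Finset.sum_congr rfl fun i hi => ?_
  simp [Finset.mem_range.1 hi]

theorem kobayashi_lt_mem_nhds [IsManifold 𝓘(ℂ, F) ω X] (x : X) {ε : ℝ≥0∞} (hε : 0 < ε) :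
    {q | kobayashi F x q < ε} ∈ 𝓝 x := by
  obtain ⟨s, hs, hs1, hsε⟩ := exists_ofReal_artanh_lt hε
  obtain ⟨U, hU, hUd⟩ := exists_disc_nhds (E := F) x univ_mem hs hs1
  filter_upwards [hU] with q hq
  obtain ⟨d, hd, hd0, rfl, -⟩ := hUd x (mem_of_mem_nhds hU) q hq
  have hsn : ‖(s : ℂ)‖ = s := by rw [Complex.norm_real, Real.norm_of_nonneg hs.le]
  have h := kobayashi_le_add x hd (mem_ball_self one_pos)
    (show (s : ℂ) ∈ ball 0 1 by rwa [mem_ball_zero_iff, hsn])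
  rw [hd0, kobayashi_self, zero_add, poincareDist_zero_left, hsn] at h
  exact h.trans_lt (hsε s hs.le le_rfl)

theorem Hyperbolic.discEquicontinuous [IsManifold 𝓘(ℂ, F) ω X] (hX : Hyperbolic F X) :
    DiscEquicontinuous F X := by
  intro x S hS
  obtain ⟨ε, hε, h⟩ := (hX.2.2 _).1 isOpen_interior x (mem_interior_iff_mem_nhds.2 hS)
  have hε2 : 0 < ε / 2 := ENNReal.half_pos hε.ne'
  obtain ⟨δ, hδ, -, hδε⟩ := exists_ofReal_artanh_lt hε2
  refine ⟨_, kobayashi_lt_mem_nhds (F := F) x hε2, δ, hδ, fun f hf hf0 t ht htδ => interior_subset (h _ ?_)⟩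
  have h1 := kobayashi_le_add x hf (mem_ball_self one_pos) ht
  rw [poincareDist_zero_left] at h1
  calc _ ≤ _ := h1
    _ < ε / 2 + ε / 2 := ENNReal.add_lt_add hf0 (hδε _ (norm_nonneg _) htδ.le)
    _ = ε := ENNReal.add_halves ε

theorem kobayashi_ne_top [IsManifold 𝓘(ℂ, F) ω X] [ConnectedSpace X] (p q : X) :
    kobayashi F p q ≠ ⊤ := by
  have hloc : ∀ x : X, ∃ U ∈ 𝓝 x, ∀ y ∈ U, ∀ z ∈ U, kobayashi F p y ≠ ⊤ →
      kobayashi F p z ≠ ⊤ := fun x => by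
    obtain ⟨s, hs, hs1, hsb, -⟩ := exists_real_ball_lt one_pos
    obtain ⟨U, hU, hUd⟩ := exists_disc_nhds (E := F) x univ_mem hs hs1
    refine ⟨U, hU, fun y hy z hz hpy => ?_⟩
    obtain ⟨d, hd, rfl, rfl, -⟩ := hUd y hy z hz
    have h := kobayashi_le_add p hd (mem_ball_self one_pos) hsb
    exact (h.trans_lt (ENNReal.add_lt_top.2 ⟨hpy.lt_top, ENNReal.ofReal_lt_top⟩)).ne
  have hclopen : IsClopen {q : X | kobayashi F p q ≠ ⊤} := by
    refine ⟨isClosed_of_closure_subset fun x hx => ?_, isOpen_iff_mem_nhds.2 fun x hx => ?_⟩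
    · obtain ⟨U, hU, h⟩ := hloc x
      obtain ⟨y, hy, hpy⟩ := mem_closure_iff_nhds.1 hx U hU
      exact h y hy x (mem_of_mem_nhds hU) hpy
    · obtain ⟨U, hU, h⟩ := hloc x
      exact mem_of_superset hU fun y hy => h x (mem_of_mem_nhds hU) y hy hx
  have := hclopen.eq_univ ⟨p, by simp [kobayashi_self]⟩
  exact this.ge (mem_univ q)

/-- Under disc-equicontinuity, short chains stay near their starting point: by the Schwarz lemma
each disc of the chain moves its point, read in a chart, by at most a constant times the Poincaré
distance. -/
theorem DiscEquicontinuous.exists_kobayashi_lt [IsManifold 𝓘(ℂ, F) ω X]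
    (hX : DiscEquicontinuous F X) (x : X) {S : Set X} (hS : S ∈ 𝓝 x) :
    ∃ ε : ℝ≥0∞, 0 < ε ∧ ∀ q : X, kobayashi F x q < ε → q ∈ S := by
  have : IsManifold 𝓘(ℂ, F) 1 X := .of_le (n := ω) le_top
  set ψ := chartAt F x
  let S' : Set X := S ∩ (ψ.source ∩ ψ ⁻¹' ball (ψ x) 1)
  have hS' : S' ∈ 𝓝 x := inter_mem hS (inter_mem (chart_source_mem_nhds F x)
    ((ψ.continuousAt (mem_chart_source F x)).preimage_mem_nhds (ball_mem_nhds _ one_pos)))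
  obtain ⟨T, hT, δ₀, hδ₀, hTδ⟩ := hX x S' hS'
  obtain ⟨δ, hδ, hδm⟩ := exists_between (lt_min hδ₀ one_pos)
  have hδ1 : δ < 1 := hδm.trans_le (min_le_right _ _)
  have hδδ₀ : δ < δ₀ := hδm.trans_le (min_le_left _ _)
  obtain ⟨ρ, hρ, -, hρT⟩ := exists_chart_ball (E := F) x (inter_mem hT hS')
  have hmemT : ∀ y ∈ ψ.source, dist (ψ y) (ψ x) < ρ → y ∈ T ∩ S' := fun y hy hyρ => by
    have := hρT (ψ y) hyρ
    rwa [ψ.left_inv hy] at this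
  -- the displacement along one disc
  have hstep : ∀ f : ℂ → X, MDifferentiableOn 𝓘(ℂ, ℂ) 𝓘(ℂ, F) f (ball 0 1) →
      ∀ a ∈ ball (0 : ℂ) 1, ∀ b ∈ ball (0 : ℂ) 1, f a ∈ T → poincareDist a b < δ →
        f b ∈ ψ.source ∧ dist (ψ (f b)) (ψ (f a)) ≤ 2 / δ * poincareDist a b := by
    intro f hf a ha b hb hfa hab
    obtain ⟨m, hm, hmm, rfl, s, hs, rfl, hsab⟩ := exists_mobius ha hb
    have hfm : MDifferentiableOn 𝓘(ℂ, ℂ) 𝓘(ℂ, F) (f ∘ m) (ball 0 1) :=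
      hf.comp (mdifferentiableOn_iff_differentiableOn.2 hm) hmm
    have hsub : ball (0 : ℂ) δ ⊆ ball 0 1 := ball_subset_ball hδ1.le
    have hfmS : ∀ t ∈ ball (0 : ℂ) δ, f (m t) ∈ S' := fun t ht =>
      hTδ (f ∘ m) hfm hfa t (hsub ht) ((mem_ball_zero_iff.1 ht).trans hδδ₀)
    have hsδ : s ∈ ball (0 : ℂ) δ := mem_ball_zero_iff.2 (hsab.trans_lt hab)
    have hd : DifferentiableOn ℂ (fun t => ψ (f (m t))) (ball 0 δ) := by
      rw [← mdifferentiableOn_iff_differentiableOn]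
      exact (mdifferentiableOn_atlas (I := 𝓘(ℂ, F)) (chart_mem_atlas F x)).comp
        (hfm.mono hsub) fun t ht => (hfmS t ht).2.1
    have h0 := hfmS 0 (mem_ball_self hδ)
    have hschwarz := Complex.dist_le_div_mul_dist_of_mapsTo_ball (R₂ := 2) hd
      (fun t ht => ?_) hsδ
    · refine ⟨(hfmS s hsδ).2.1, hschwarz.trans ?_⟩
      rw [dist_zero_right]
      gcongr
    · have h1 := mem_ball.1 (hfmS t ht).2.2
      have h2 := mem_ball.1 h0.2.2
      have := dist_triangle_right (ψ (f (m t))) (ψ (f (m 0))) (ψ x)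
      exact mem_closedBall.2 (by linarith)
  -- length below `δ` makes `hstep` applicable to each disc, and length below `ρ * δ / 2` keeps the
  -- total displacement below `ρ`, so that every point of the chain is the start of a disc in `T`
  refine ⟨ENNReal.ofReal (min δ (ρ * δ / 2)), ENNReal.ofReal_pos.2 (by positivity), fun q hq => ?_⟩
  obtain ⟨c, hc⟩ := iInf_lt_iff.1 hq
  have hdist : ∀ i, 0 ≤ poincareDist (c.a i) (c.b i) := fun i =>
    Real.artanh_nonneg (norm_nonneg _)
  rw [HolChain.length, ← ENNReal.ofReal_sum_of_nonneg fun i _ => hdist i,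
    ENNReal.ofReal_lt_ofReal_iff (by positivity), lt_min_iff] at hc
  have hle : ∀ i ≤ c.n, ∑ j ∈ Finset.range i, poincareDist (c.a j) (c.b j) ≤
      ∑ j ∈ Finset.range c.n, poincareDist (c.a j) (c.b j) := fun i hi =>
    Finset.sum_le_sum_of_subset_of_nonneg (Finset.range_subset_range.2 hi) fun j _ _ => hdist j
  have hlt : ∀ i ≤ c.n, 2 / δ * ∑ j ∈ Finset.range i, poincareDist (c.a j) (c.b j) < ρ :=
    fun i hi => by
      rw [div_mul_eq_mul_div, div_lt_iff₀ hδ]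
      linarith [hle i hi, hc.2]
  have hind : ∀ i ≤ c.n, c.pt i ∈ ψ.source ∧ dist (ψ (c.pt i)) (ψ x) ≤
      2 / δ * ∑ j ∈ Finset.range i, poincareDist (c.a j) (c.b j) := by
    intro i
    induction i with
    | zero =>
      intro _
      rw [c.pt_zero]
      exact ⟨mem_chart_source F x, by simp⟩
    | succ i ih =>
      intro hi
      obtain ⟨h1, h2⟩ := ih (Nat.le_of_succ_le hi)
      have hT := (hmemT _ h1 (h2.trans_lt (hlt i (Nat.le_of_succ_le hi)))).1
      have hpo : poincareDist (c.a i) (c.b i) < δ := by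
        refine lt_of_le_of_lt ?_ hc.1
        exact Finset.single_le_sum (f := fun j => poincareDist (c.a j) (c.b j))
          (fun j _ => hdist j) (Finset.mem_range.2 hi)
      obtain ⟨h3, h4⟩ := hstep _ (c.holo i hi) _ (c.a_mem i hi) _ (c.b_mem i hi)
        (by rwa [c.map_a i hi]) hpo
      rw [c.map_b i hi] at h3
      rw [c.map_b i hi, c.map_a i hi] at h4
      refine ⟨h3, ?_⟩
      rw [Finset.sum_range_succ, mul_add]
      linarith [dist_triangle (ψ (c.pt (i + 1))) (ψ (c.pt i)) (ψ x)]
  obtain ⟨h1, h2⟩ := hind c.n le_rfl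
  rw [c.pt_last] at h1 h2
  exact (hmemT q h1 (h2.trans_lt (hlt _ le_rfl))).2.1

theorem hyperbolic_iff_discEquicontinuous [IsManifold 𝓘(ℂ, F) ω X] [ConnectedSpace X]
    [T2Space X] : Hyperbolic F X ↔ DiscEquicontinuous F X := by
  refine ⟨Hyperbolic.discEquicontinuous, fun hX => ⟨kobayashi_ne_top, fun p q hpq => ?_,
    fun S => ⟨fun hS p hp => hX.exists_kobayashi_lt p (hS.mem_nhds hp), fun h => ?_⟩⟩⟩
  · by_contra hne
    obtain ⟨ε, hε, h⟩ := hX.exists_kobayashi_lt p (isOpen_compl_singleton.mem_nhds hne)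
    exact h q (hpq ▸ hε) rfl
  · refine isOpen_iff_mem_nhds.2 fun p hp => ?_
    obtain ⟨ε, hε, hpS⟩ := h p hp
    exact mem_of_superset (kobayashi_lt_mem_nhds p hε) hpS

end Kobayashi

/-! ### Universe-lifted models of open subsets of Banach spaces -/

section Models

/-- A connected open subset of a Banach space in `Type`, as a Banach analytic manifold in arbitrary
universes, with the mutually inverse holomorphic maps `π` and `σ` between the two. -/
theorem exists_manifold_model (E₀ : Type) [NormedAddCommGroup E₀] [NormedSpace ℂ E₀]
    [CompleteSpace E₀] {U : Set E₀} (hU : IsOpen U) (hUc : IsConnected U) :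
    ∃ (E : Type b) (_ : NormedAddCommGroup E) (_ : NormedSpace ℂ E) (_ : CompleteSpace E)
      (A : Type a) (_ : TopologicalSpace A) (_ : T2Space A) (_ : ConnectedSpace A)
      (_ : ChartedSpace E A) (_ : IsManifold 𝓘(ℂ, E) ω A) (π : A → E₀) (σ : E₀ → A),
      Topology.IsOpenEmbedding π ∧ MDifferentiable 𝓘(ℂ, E) 𝓘(ℂ, E₀) π ∧
        MDifferentiableOn 𝓘(ℂ, E₀) 𝓘(ℂ, E) σ U ∧ (∀ y ∈ U, π (σ y) = y) ∧
        ∀ z, π z ∈ U ∧ σ (π z) = z := by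
  have : ConnectedSpace U := isConnected_iff_connectedSpace.1 hUc
  have : ConnectedSpace (ULift.{a} U) :=
    (Homeomorph.ulift (X := U)).symm.surjective.connectedSpace Homeomorph.ulift.symm.continuous
  let e : ULift.{b} E₀ ≃L[ℂ] E₀ := ContinuousLinearEquiv.ulift
  let ι : ULift.{a} U → ULift.{b} E₀ := fun z => ULift.up z.down.1
  have hι : Topology.IsOpenEmbedding ι := Homeomorph.ulift.symm.isOpenEmbedding.comp
    (hU.isOpenEmbedding_subtypeVal.comp Homeomorph.ulift.isOpenEmbedding)
  let _ : ChartedSpace (ULift.{b} E₀) (ULift.{a} U) := hι.singletonChartedSpace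
  have hι1 : ContMDiff 𝓘(ℂ, ULift.{b} E₀) 𝓘(ℂ, ULift.{b} E₀) 1 ι := contMDiff_isOpenEmbedding hι
  have hι2 := contMDiffOn_isOpenEmbedding_symm (I := 𝓘(ℂ, ULift.{b} E₀)) hι (n := 1)
  have hrange : ∀ y ∈ U, e.symm y ∈ range ι := fun y hy => ⟨⟨⟨y, hy⟩⟩, rfl⟩
  refine ⟨ULift.{b} E₀, inferInstance, inferInstance, inferInstance, ULift.{a} U, inferInstance,
    inferInstance, inferInstance, inferInstance, hι.isManifold_singleton,
    fun z => z.down.1, fun y => (hι.toOpenPartialHomeomorph ι).symm (e.symm y), ?_, ?_, ?_, ?_, ?_⟩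
  · exact hU.isOpenEmbedding_subtypeVal.comp Homeomorph.ulift.isOpenEmbedding
  · exact (mdifferentiable_iff_differentiable.2 e.differentiable).comp
      (hι1.mdifferentiable one_ne_zero)
  · exact (hι2.mdifferentiableOn one_ne_zero).comp
      (mdifferentiable_iff_differentiable.2 e.symm.differentiable).mdifferentiableOn hrange
  · intro y hy
    exact congrArg ULift.down (hι.toOpenPartialHomeomorph_right_inv ι (hrange y hy))
  · intro z
    exact ⟨z.down.2, hι.toOpenPartialHomeomorph_left_inv ι⟩

end Models

/-! ### Uniqueness points -/

section Uniqueness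

variable {E : Type*} [NormedAddCommGroup E] [NormedSpace ℂ E]
  {A : Type*} [TopologicalSpace A] [ChartedSpace E A]

/-- If `S` is dense in an open set, then it is a uniqueness set at the closure of that open set. -/
theorem mem_uniquenessPoints_of_subset_closure [IsManifold 𝓘(ℂ, E) ω A] {S V : Set A}
    (hV : IsOpen V) (hVS : V ⊆ closure S) {z : A} (hz : z ∈ closure V) :
    z ∈ uniquenessPoints E S := by
  refine ⟨closure_minimal hVS isClosed_closure hz, fun U hU hUc hzU g hg hg0 => ?_⟩
  refine eqOn_of_eqOn_open (g := fun _ => (0 : ℂ)) hU hUc.isPreconnected hg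
    (mdifferentiableOn_const) hV (mem_closure_iff.1 hz U hU hzU) fun p hp => ?_
  by_contra hne
  have hgp : ContinuousAt g p := hg.continuousOn.continuousAt (hU.mem_nhds hp.1)
  obtain ⟨q, hq, hqS⟩ := mem_closure_iff_nhds.1 (hVS hp.2) _
    (inter_mem (hU.mem_nhds hp.1) (hgp.eventually_ne hne))
  exact hq.2 (hg0 q ⟨hq.1, hqS⟩)

end Uniqueness

/-! ### The weak Vitali property implies disc-equicontinuity -/

section WeakVitali

variable {F : Type v} [NormedAddCommGroup F] [NormedSpace ℂ F]
  {X : Type u} [TopologicalSpace X] [ChartedSpace F X]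

theorem tendsto_hol_apply {E : Type*} [NormedAddCommGroup E] [NormedSpace ℂ E] {A : Type*}
    [TopologicalSpace A] [ChartedSpace E A] {f : ℕ → Hol E A F X} {g : Hol E A F X}
    (h : Tendsto f atTop (𝓝 g)) (z : A) : Tendsto (fun k => (f k).1 z) atTop (𝓝 (g.1 z)) :=
  ((continuous_eval_const z).tendsto _).comp (tendsto_subtype_rng.1 h)

/-- The Hilbert space of square-summable sequences. -/
abbrev Ell2 : Type := lp (fun _ : ℕ => ℂ) 2

theorem exists_ell2_single (n : ℕ) (c : ℂ) : ∃ y : Ell2, ‖y‖ = ‖c‖ ∧ y n = c :=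
  ⟨lp.single (E := fun _ : ℕ => ℂ) 2 n c, lp.norm_single (E := fun _ : ℕ => ℂ) two_pos n c,
    lp.single_apply_self (E := fun _ : ℕ => ℂ) 2 n c⟩

/-- The main consequence of the weak Vitali property: discs `f n` whose centres converge to `x`
cannot stay away from `x` at parameters tending to `0`. The maps `y ↦ f n (y n)` on the unit ball
of `ℓ²` converge to `x` on the dense set of the finitely supported `y`, hence uniformly on the
compact set formed by `0` and the multiples `t n` of the basis vectors. -/
theorem WVP.exists_disc_mem [T2Space X] (hX : WVP.{u, v, a, b} F X) {f : ℕ → ℂ → X}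
    (hf : ∀ n, MDifferentiableOn 𝓘(ℂ, ℂ) 𝓘(ℂ, F) (f n) (ball 0 1)) {x : X}
    (hfx : Tendsto (fun n => f n 0) atTop (𝓝 x)) {t : ℕ → ℂ} (ht : ∀ n, t n ∈ ball (0 : ℂ) 1)
    (ht0 : Tendsto (fun n => ‖t n‖) atTop (𝓝 0)) {S : Set X} (hS : S ∈ 𝓝 x) :
    ∃ n, f n (t n) ∈ S := by
  obtain ⟨E, _, _, _, A, _, _, _, _, _, π, σ, hπ, hπd, hσ, hπσ, hσπ⟩ :=
    exists_manifold_model.{a, b} Ell2 (isOpen_ball (x := 0) (ε := 1)) (isConnected_ball one_pos)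
  have hcoord : ∀ n, Differentiable ℂ fun y : Ell2 => y n := fun n =>
    (lp.evalCLM ℂ (fun _ : ℕ => ℂ) 2 n).differentiable
  have hmaps : ∀ n z, (π z) n ∈ ball (0 : ℂ) 1 := fun n z =>
    mem_ball_zero_iff.2 ((lp.norm_apply_le_norm two_ne_zero (π z) n).trans_lt
      (mem_ball_zero_iff.1 (hσπ z).1))
  have hg : ∀ n, MDifferentiable 𝓘(ℂ, E) 𝓘(ℂ, F) fun z => f n (π z n) := fun n => by
    rw [← mdifferentiableOn_univ]
    exact (hf n).comp ((mdifferentiable_iff_differentiable.2 (hcoord n)).comp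
      hπd).mdifferentiableOn fun z _ => hmaps n z
  let g : ℕ → Hol E A F X := fun n => ⟨⟨fun z => f n (π z n), (hg n).continuous⟩, hg n⟩
  have hσc : ∀ y ∈ ball (0 : Ell2) 1, ContinuousAt σ y := fun y hy =>
    hσ.continuousOn.continuousAt (isOpen_ball.mem_nhds hy)
  have h0 : (0 : Ell2) ∈ ball (0 : Ell2) 1 := mem_ball_self one_pos
  -- points with finitely many nonzero coordinates are points of convergence
  have hZ : ∀ z, (∀ᶠ n in atTop, π z n = 0) → Tendsto (fun n => (g n).1 z) atTop (𝓝 x) :=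
    fun z hz => hfx.congr' (hz.mono fun n hn => by simp [g, hn])
  have hz0 : Tendsto (fun n => (g n).1 (σ 0)) atTop (𝓝 x) :=
    hZ _ (Eventually.of_forall fun n => by rw [hπσ 0 h0]; rfl)
  have hdense : ∀ z, z ∈ closure (convergenceSet fun n => ((g n).1 : A → X)) := by
    intro z
    have hsum : Tendsto (fun N => ∑ i ∈ Finset.range N, lp.single 2 i (π z i)) atTop (𝓝 (π z)) :=
      (lp.hasSum_single ENNReal.ofNat_ne_top (π z)).tendsto_sum_nat
    have h1 := (hσc _ (hσπ z).1).tendsto.comp hsum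
    rw [(hσπ z).2] at h1
    refine mem_closure_of_tendsto h1 ?_
    filter_upwards [hsum.eventually_mem (isOpen_ball.mem_nhds (hσπ z).1)] with N hN
    refine ⟨x, hZ _ ?_⟩
    filter_upwards [eventually_ge_atTop N] with n hn
    rw [Function.comp_apply, hπσ _ hN, lp.coeFn_sum, Finset.sum_apply]
    exact Finset.sum_eq_zero fun i hi =>
      lp.single_apply_ne _ _ _ ((Finset.mem_range.1 hi).trans_le hn).ne'
  obtain ⟨G, hG⟩ := hX E A g ⟨σ 0, ⟨x, hz0⟩, mem_uniquenessPoints_of_subset_closure isOpen_univ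
    (fun z _ => hdense z) (subset_closure (mem_univ _))⟩
  have hG' : Tendsto (fun n => (g n).1) atTop (𝓝 G.1) := tendsto_subtype_rng.1 hG
  have hG0 : G.1 (σ 0) = x := tendsto_nhds_unique (tendsto_hol_apply hG (σ 0)) hz0
  choose y hyn hyt using fun n => exists_ell2_single n (t n)
  have hyb : ∀ n, y n ∈ ball (0 : Ell2) 1 := fun n => by
    rw [mem_ball_zero_iff, hyn]
    exact mem_ball_zero_iff.1 (ht n)
  have hy0 : Tendsto y atTop (𝓝 0) := by
    rw [tendsto_zero_iff_norm_tendsto_zero]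
    simpa only [hyn] using ht0
  have hσy : Tendsto (fun n => σ (y n)) atTop (𝓝 (σ 0)) := (hσc 0 h0).tendsto.comp hy0
  have hO : G.1 ⁻¹' interior S ∈ 𝓝 (σ 0) :=
    G.1.continuous.continuousAt.preimage_mem_nhds
      (isOpen_interior.mem_nhds (by rw [hG0]; exact mem_interior_iff_mem_nhds.2 hS))
  obtain ⟨N, hN⟩ := eventually_atTop.1 (hσy.eventually_mem hO)
  have hK := ((tendsto_add_atTop_iff_nat N).2 hσy).isCompact_insert_range
  have hev := ContinuousMap.tendsto_nhds_compactOpen.1 hG' _ hK _ isOpen_interior (by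
    rintro _ (rfl | ⟨n, rfl⟩)
    · exact (mem_of_mem_nhds hO : σ 0 ∈ G.1 ⁻¹' interior S)
    · exact hN _ (Nat.le_add_left N n))
  obtain ⟨n, hn, hnN⟩ := (hev.and (eventually_ge_atTop N)).exists
  have h2 : f n (π (σ (y n)) n) ∈ interior S :=
    hn (Or.inr ⟨n - N, by simp only [Nat.sub_add_cancel hnN]⟩)
  rw [hπσ _ (hyb n), hyt] at h2
  exact ⟨n, interior_subset h2⟩

/-- The weak Vitali property implies disc-equicontinuity. -/
theorem WVP.discEquicontinuous [T2Space X] (hX : WVP.{u, v, a, b} F X) :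
    DiscEquicontinuous F X := by
  by_contra hcon
  unfold DiscEquicontinuous at hcon
  push Not at hcon
  obtain ⟨x, S, hS, hcon⟩ := hcon
  have := firstCountableTopology_of_chartedSpace F X
  obtain ⟨T, hT⟩ := (𝓝 x).exists_antitone_basis
  choose f hf hf0 t ht htn htS using fun n : ℕ =>
    hcon (T n) (hT.1.mem_of_mem trivial) (1 / ((n : ℝ) + 1)) (by positivity)
  obtain ⟨n, hn⟩ := hX.exists_disc_mem hf (hT.tendsto hf0) ht
    (squeeze_zero (fun n => norm_nonneg _) (fun n => (htn n).le)
      tendsto_one_div_add_atTop_nhds_zero_nat) hS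
  exact htS n hn

end WeakVitali

/-! ### The subsequence alternative implies the weak Vitali property -/

section Alternative

variable {F : Type v} [NormedAddCommGroup F] [NormedSpace ℂ F]
  {X : Type u} [TopologicalSpace X] [ChartedSpace F X]

variable (F X) in
/-- Every sequence of holomorphic maps from a separable Banach analytic manifold into `X` has a
subsequence that converges or is compactly divergent on an open dense set. -/
def SubsequenceAlternative : Prop :=
  ∀ (E : Type b) [NormedAddCommGroup E] [NormedSpace ℂ E] [CompleteSpace E]
    (A : Type a) [TopologicalSpace A] [T2Space A] [ConnectedSpace A]
    [ChartedSpace E A] [IsManifold 𝓘(ℂ, E) ω A] [TopologicalSpace.SeparableSpace A]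
    (f : ℕ → Hol E A F X),
    ∃ φ : ℕ → ℕ, StrictMono φ ∧
      ((∃ g : Hol E A F X, Tendsto (fun j => f (φ j)) atTop (𝓝 g)) ∨
        ∃ W : Set A, IsOpen W ∧ Dense W ∧
          CompactlyDivergentOn (fun j => ((f (φ j)).1 : A → X)) W)

/-- The alternative for discs: convergence on an open set rules out compact divergence. -/
theorem SubsequenceAlternative.exists_disc_limit (hX : SubsequenceAlternative.{u, v, a, b} F X)
    {h : ℕ → ℂ → X} (hh : ∀ k, MDifferentiableOn 𝓘(ℂ, ℂ) 𝓘(ℂ, F) (h k) (ball 0 1)) {V : Set ℂ}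
    (hV : IsOpen V) (hVne : (ball 0 1 ∩ V).Nonempty)
    (hconv : ∀ t ∈ ball 0 1 ∩ V, t ∈ convergenceSet h) :
    ∃ φ : ℕ → ℕ, StrictMono φ ∧ ∃ g : ℂ → X, MDifferentiableOn 𝓘(ℂ, ℂ) 𝓘(ℂ, F) g (ball 0 1) ∧
      ∀ t ∈ ball (0 : ℂ) 1, Tendsto (fun j => h (φ j) t) atTop (𝓝 (g t)) := by
  obtain ⟨E, _, _, _, A, _, _, _, _, _, π, σ, hπ, hπd, hσ, hπσ, hσπ⟩ :=
    exists_manifold_model.{a, b} ℂ (isOpen_ball (x := 0) (ε := 1)) (isConnected_ball one_pos)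
  have := hπ.isInducing.secondCountableTopology
  have hd : ∀ k, MDifferentiable 𝓘(ℂ, E) 𝓘(ℂ, F) (h k ∘ π) := fun k => by
    rw [← mdifferentiableOn_univ]
    exact (hh k).comp hπd.mdifferentiableOn fun z _ => (hσπ z).1
  obtain ⟨φ, hφ, ⟨g, hg⟩ | ⟨W, -, hWd, hW⟩⟩ :=
    hX E A fun k => ⟨⟨h k ∘ π, (hd k).continuous⟩, hd k⟩
  · refine ⟨φ, hφ, g.1 ∘ σ, g.2.comp_mdifferentiableOn hσ, fun t ht => ?_⟩
    have := tendsto_hol_apply hg (σ t)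
    simpa only [ContinuousMap.coe_mk, Function.comp_apply, hπσ t ht] using this
  · exfalso
    obtain ⟨t, ht⟩ := hVne
    obtain ⟨z, hzV, hzW⟩ := hWd.inter_open_nonempty _ (hV.preimage hπ.continuous)
      ⟨σ t, by rw [mem_preimage, hπσ t ht.1]; exact ht.2⟩
    obtain ⟨y, hy⟩ := hconv (π z) ⟨(hσπ z).1, hzV⟩
    obtain ⟨k₀, hk₀⟩ := hW {z} (singleton_subset_iff.2 hzW) isCompact_singleton _
      (hy.comp hφ.tendsto_atTop).isCompact_insert_range
    exact eq_empty_iff_forall_notMem.1 (hk₀ k₀ le_rfl) (h (φ k₀) (π z))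
      ⟨⟨z, rfl, rfl⟩, Or.inr ⟨k₀, rfl⟩⟩

theorem SubsequenceAlternative.exists_tendsto_zero [T2Space X] [IsManifold 𝓘(ℂ, F) ω X]
    [CompleteSpace F] (hX : SubsequenceAlternative.{u, v, a, b} F X)
    {h : ℕ → ℂ → X} (hh : ∀ k, MDifferentiableOn 𝓘(ℂ, ℂ) 𝓘(ℂ, F) (h k) (ball 0 1)) {V : Set ℂ}
    (hV : IsOpen V) (hVne : (ball 0 1 ∩ V).Nonempty)
    (hconv : ∀ t ∈ ball 0 1 ∩ V, t ∈ convergenceSet h) : 0 ∈ convergenceSet h := by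
  obtain ⟨φ, hφ, g, hgd, hg⟩ := hX.exists_disc_limit hh hV hVne hconv
  refine ⟨g 0, tendsto_of_subseq_tendsto fun ns hns => ?_⟩
  obtain ⟨ρ, hρ, hnsρ⟩ := strictMono_subseq_of_tendsto_atTop hns
  have hconv' : ∀ t ∈ ball 0 1 ∩ V, t ∈ convergenceSet fun k => h (ns (ρ k)) := fun t ht =>
    (hconv t ht).imp fun y hy => hy.comp hnsρ.tendsto_atTop
  obtain ⟨φ', hφ', g', hgd', hg'⟩ :=
    hX.exists_disc_limit (fun k => hh (ns (ρ k))) hV hVne hconv'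
  -- the limits agree where the whole sequence converges, hence everywhere
  have heq : EqOn g' g (ball 0 1) :=
    eqOn_of_eqOn_open isOpen_ball (convex_ball 0 1).isPreconnected hgd' hgd hV hVne fun t ht => by
      obtain ⟨y, hy⟩ := hconv t ht
      rw [tendsto_nhds_unique (hg' t ht.1) (hy.comp (hnsρ.comp hφ').tendsto_atTop),
        tendsto_nhds_unique (hg t ht.1) (hy.comp hφ.tendsto_atTop)]
  refine ⟨fun n => ρ (φ' n), ?_⟩
  rw [← heq (mem_ball_self one_pos)]
  exact hg' 0 (mem_ball_self one_pos)

/-- The alternative and disc-equicontinuity imply the weak Vitali property: convergence propagates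
from the interior of the convergence set to its closure along discs, and there the equicontinuity
makes the point of convergence an interior one again. -/
theorem SubsequenceAlternative.wvp [T2Space X] [IsManifold 𝓘(ℂ, F) ω X]
    [CompleteSpace F] (hX : SubsequenceAlternative.{u, v, a, b} F X)
    (hXe : DiscEquicontinuous F X) : WVP.{u, v, a, b} F X := by
  intro E _ _ _ A _ _ _ _ _ f ⟨z₀, hz₀, hz₀u⟩
  set Z := convergenceSet fun k => ((f k).1 : A → X) with hZ
  have hint : ∀ z ∈ Z, z ∈ uniquenessPoints E Z → z ∈ interior Z := fun z hz hzu =>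
    mem_interior_iff_mem_nhds.2 (hXe.convergenceSet_mem_nhds (fun k => (f k).2) hz hzu)
  have hclosed : IsClosed (interior Z) := by
    refine isClosed_of_closure_subset fun z hz => hint z ?_
      (mem_uniquenessPoints_of_subset_closure isOpen_interior
        (interior_subset.trans subset_closure) hz)
    obtain ⟨s, hs, hs1, hsb, -⟩ := exists_real_ball_lt one_pos
    obtain ⟨U, hU, hUd⟩ := exists_disc_nhds (E := E) z univ_mem hs hs1
    obtain ⟨w, hwU, hwZ⟩ := mem_closure_iff_nhds.1 hz U hU
    obtain ⟨d, hd, hd0, hds, -⟩ := hUd z (mem_of_mem_nhds hU) w hwU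
    obtain ⟨V, hV, hVd⟩ := (continuousOn_iff'.1 hd.continuousOn) _ (isOpen_interior (s := Z))
    have hVd' : ball 0 1 ∩ V = d ⁻¹' interior Z ∩ ball 0 1 := by rw [hVd, inter_comm]
    have := hX.exists_tendsto_zero (h := fun k => (f k).1 ∘ d) (V := V)
      (fun k => (f k).2.comp_mdifferentiableOn hd) hV
      ⟨s, hVd'.symm ▸ ⟨by rwa [mem_preimage, hds], hsb⟩⟩
      (fun t ht => by
        rw [hVd'] at ht
        exact interior_subset (s := Z) ht.1)
    exact this.imp fun y hy => by simpa only [Function.comp_apply, hd0] using hy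
  have huniv := IsClopen.eq_univ ⟨hclosed, isOpen_interior⟩ ⟨z₀, hint z₀ hz₀ hz₀u⟩
  choose g hg using fun z : A => interior_subset (s := Z) (huniv.ge (mem_univ z))
  exact hXe.exists_tendsto_hol f hg

end Alternative

/-! ### Diagonal subsequences and π-bases -/

section Diagonal

/-- A diagonal argument: if each property `P j` holds for some refinement of every subsequence, there
is one subsequence whose tails refine, for every `j`, a subsequence with property `P j`. -/
theorem exists_diagonal_subseq (P : ℕ → (ℕ → ℕ) → Prop)
    (hP : ∀ j φ, StrictMono φ → ∃ ρ : ℕ → ℕ, StrictMono ρ ∧ P j (φ ∘ ρ)) :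
    ∃ φ : ℕ → ℕ, StrictMono φ ∧ ∀ j, ∃ ψ e : ℕ → ℕ, P j ψ ∧ StrictMono e ∧
      ∀ k, φ (j + k + 1) = ψ (e k) := by
  choose! ρ hρ hPρ using hP
  let Φ : ℕ → ℕ → ℕ := fun j => j.rec id fun j φ => φ ∘ ρ j φ
  have hΦs : ∀ j, Φ (j + 1) = Φ j ∘ ρ j (Φ j) := fun j => rfl
  have hΦ : ∀ j, StrictMono (Φ j) := fun j => by
    induction j with
    | zero => exact strictMono_id
    | succ j ih => exact ih.comp (hρ j _ ih)
  have hφ : StrictMono fun k => Φ k k := strictMono_nat_of_lt_succ fun k =>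
    hΦ k ((Nat.lt_succ_self k).trans_le ((hρ k _ (hΦ k)).le_apply))
  have hsub : ∀ j m i, ∃ i', Φ (j + m) i = Φ j i' := fun j m => by
    induction m with
    | zero => exact fun i => ⟨i, rfl⟩
    | succ m ih => exact fun i => ih _
  refine ⟨fun k => Φ k k, hφ, fun j => ?_⟩
  choose e he using fun k => hsub (j + 1) k (j + 1 + k)
  refine ⟨Φ (j + 1), e, hPρ j _ (hΦ j), fun k l hkl => ?_, fun k => ?_⟩
  · rw [← (hΦ (j + 1)).lt_iff_lt, ← he, ← he]
    exact hφ (by simpa using hkl)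
  · rw [← he, add_right_comm]

/-- By a diagonal argument, some subsequence satisfies for each of countably many sets: either it
converges at a point of the set, or none of its subsequences converges at any point of it. -/
theorem exists_subseq_dichotomy {A X : Type*} [TopologicalSpace X] (f : ℕ → A → X)
    (U : ℕ → Set A) : ∃ φ : ℕ → ℕ, StrictMono φ ∧ ∀ j,
      (∃ z ∈ U j, z ∈ convergenceSet fun k => f (φ k)) ∨
        ∀ z ∈ U j, ∀ ψ : ℕ → ℕ, StrictMono ψ → z ∉ convergenceSet fun k => f (φ (ψ k)) := by
  obtain ⟨φ, hφ, h⟩ := exists_diagonal_subseq (fun j φ =>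
      (∃ z ∈ U j, z ∈ convergenceSet fun k => f (φ k)) ∨
        ∀ z ∈ U j, ∀ ψ : ℕ → ℕ, StrictMono ψ → z ∉ convergenceSet fun k => f (φ (ψ k)))
    fun j φ hφ => by
      by_cases hc : ∃ ρ : ℕ → ℕ, StrictMono ρ ∧
          ∃ z ∈ U j, z ∈ convergenceSet fun k => f (φ (ρ k))
      · obtain ⟨ρ, hρ, hz⟩ := hc
        exact ⟨ρ, hρ, Or.inl hz⟩
      · refine ⟨id, strictMono_id, Or.inr fun z hz ψ hψ hzψ => hc ⟨ψ, hψ, z, hz, hzψ⟩⟩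
  refine ⟨φ, hφ, fun j => ?_⟩
  obtain ⟨ψ, e, hψ, he, hφψ⟩ := h j
  refine hψ.imp (fun ⟨z, hz, x, hx⟩ => ⟨z, hz, x, ?_⟩) fun hdiv z hz χ hχ hzχ => ?_
  · obtain ⟨x, hx⟩ := hzχ
    have hle : ∀ k, j + 1 ≤ χ (k + (j + 1)) := fun k =>
      (Nat.le_add_left _ _).trans hχ.le_apply
    -- `χ (k + (j + 1)) - (j + 1)` indexes the tail of the subsequence inside `ψ`
    refine hdiv z hz (fun k => e (χ (k + (j + 1)) - (j + 1)))
      (fun k l hkl => he ?_) ⟨x, ?_⟩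
    · have := hχ (Nat.add_lt_add_right hkl (j + 1))
      have := hle k
      show _ - _ < _ - _
      omega
    · refine ((tendsto_add_atTop_iff_nat (j + 1)).2 hx).congr fun k => ?_
      have := hle k
      simp only [← hφψ]
      rw [show j + (χ (k + (j + 1)) - (j + 1)) + 1 = χ (k + (j + 1)) by omega]
  · rw [← tendsto_add_atTop_iff_nat (j + 1)]
    refine (hx.comp he.tendsto_atTop).congr fun k => ?_
    simp only [Function.comp_apply, ← hφψ]
    rw [show j + k + 1 = k + (j + 1) by omega]

theorem exists_countable_piBase (A : Type*) [TopologicalSpace A] [FirstCountableTopology A]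
    [TopologicalSpace.SeparableSpace A] [Nonempty A] :
    ∃ U : ℕ → Set A, (∀ j, IsOpen (U j)) ∧
      ∀ V : Set A, IsOpen V → V.Nonempty → ∃ j, U j ⊆ V ∧ (U j).Nonempty := by
  let p := TopologicalSpace.denseSeq A
  choose B hB using fun n => (𝓝 (p n)).exists_antitone_basis
  refine ⟨fun j => interior (B j.unpair.1 j.unpair.2), fun j => isOpen_interior,
    fun V hV hVne => ?_⟩
  obtain ⟨_, hnV, n, rfl⟩ := (TopologicalSpace.denseRange_denseSeq A).inter_open_nonempty V hV hVne
  obtain ⟨m, -, hm⟩ := (hB n).1.mem_iff.1 (hV.mem_nhds hnV)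
  refine ⟨Nat.pair n m, ?_, p n, ?_⟩
  · simpa using interior_subset.trans hm
  · simpa using mem_interior_iff_mem_nhds.2 ((hB n).1.mem_of_mem trivial)

end Diagonal

/-! ### The weak Vitali property implies the subsequence alternative -/

section Divergence

variable {F : Type v} [NormedAddCommGroup F] [NormedSpace ℂ F]
  {X : Type u} [TopologicalSpace X] [ChartedSpace F X]

/-- A subsequence chosen along a countable π-base of `A` either converges on a set that is dense
somewhere, where the weak Vitali property applies, or is compactly divergent on the union of the
members of the π-base without any point of convergence of a subsequence. -/
theorem WVP.subsequenceAlternative [T2Space X] (hX : WVP.{u, v, a, b} F X) :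
    SubsequenceAlternative.{u, v, a, b} F X := by
  intro E _ _ _ A _ _ _ _ _ _ f
  have hXe := hX.discEquicontinuous
  have := firstCountableTopology_of_chartedSpace E A
  have := firstCountableTopology_of_chartedSpace F X
  obtain ⟨U, hUo, hU⟩ := exists_countable_piBase A
  obtain ⟨φ, hφ, hφU⟩ := exists_subseq_dichotomy (fun k => ((f k).1 : A → X)) U
  refine ⟨φ, hφ, ?_⟩
  set Z := convergenceSet fun k => ((f (φ k)).1 : A → X) with hZ
  by_cases hc : ∃ V : Set A, IsOpen V ∧ V.Nonempty ∧ V ⊆ closure Z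
  · obtain ⟨V, hV, ⟨w, hw⟩, hVZ⟩ := hc
    obtain ⟨z, hzV, hzZ⟩ := mem_closure_iff.1 (hVZ hw) V hV hw
    exact Or.inl (hX E A (fun k => f (φ k))
      ⟨z, hzZ, mem_uniquenessPoints_of_subset_closure hV hVZ (subset_closure hzV)⟩)
  · right
    let J : Set ℕ := {j | ∀ z ∈ U j, ∀ ψ : ℕ → ℕ, StrictMono ψ →
      z ∉ convergenceSet fun k => ((f (φ (ψ k))).1 : A → X)}
    refine ⟨⋃ j ∈ J, U j, isOpen_biUnion fun j _ => hUo j, ?_, fun K hK hKc L hL => ?_⟩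
    · refine dense_iff_inter_open.2 fun V hV hVne => ?_
      have hVZ : (V ∩ (closure Z)ᶜ).Nonempty := by
        by_contra hne
        refine hc ⟨V, hV, hVne, ?_⟩
        rwa [not_nonempty_iff_eq_empty, ← sdiff_eq, sdiff_eq_empty] at hne
      obtain ⟨j, hjV, z, hz⟩ := hU _ (hV.inter isClosed_closure.isOpen_compl) hVZ
      have hj : j ∈ J := (hφU j).resolve_left fun ⟨w, hw, hwZ⟩ =>
        (hjV hw).2 (subset_closure hwZ)
      exact ⟨z, (hjV hz).1, mem_biUnion hj hz⟩
    · by_contra hcon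
      push Not at hcon
      obtain ⟨ψ, hψ, hψn⟩ := extraction_of_frequently_atTop (frequently_atTop.2 hcon)
      choose y hy using hψn
      choose z hz using fun n => (hy n).1
      obtain ⟨z₀, hz₀, α, hα, hzα⟩ := hKc.tendsto_subseq fun n => (hz n).1
      obtain ⟨x, -, β, hβ, hxβ⟩ := hL.tendsto_subseq fun n => (hy (α n)).2
      obtain ⟨j, hj, hzj⟩ := mem_iUnion₂.1 (hK hz₀)
      -- by equicontinuity the values at the limit `z₀` of the points have the same limit `x`
      refine hj z₀ hzj (ψ ∘ α ∘ β) (hψ.comp (hα.comp hβ)) ⟨x, tendsto_def.2 fun S hS => ?_⟩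
      obtain ⟨T, hT, V, hV, hTV⟩ := hXe.exists_nhds (E := E) z₀ x hS
      filter_upwards [hxβ.eventually_mem hT,
        (hzα.comp hβ.tendsto_atTop).eventually_mem hV] with n hnT hnV
      refine hTV _ (f (φ (ψ (α (β n))))).2 _ hnV z₀ (mem_of_mem_nhds hV) ?_
      exact mem_of_eq_of_mem (hz (α (β n))).2 hnT

end Divergence

end BanachVitali
end

theorem theorem3p10
    (F : Type v) [NormedAddCommGroup F] [NormedSpace ℂ F] [CompleteSpace F]
    (X : Type u) [TopologicalSpace X] [T2Space X] [ConnectedSpace X]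
    [ChartedSpace F X] [IsManifold 𝓘(ℂ, F) ω X] :
    BanachVitali.WVP.{u, v, a, b} F X ↔
      BanachVitali.Hyperbolic F X ∧
      ∀ (E : Type b) [NormedAddCommGroup E] [NormedSpace ℂ E] [CompleteSpace E]
        (A : Type a) [TopologicalSpace A] [T2Space A] [ConnectedSpace A]
        [ChartedSpace E A] [IsManifold 𝓘(ℂ, E) ω A] [TopologicalSpace.SeparableSpace A]
        (f : ℕ → BanachVitali.Hol E A F X),
        ∃ φ : ℕ → ℕ, StrictMono φ ∧
          ((∃ g : BanachVitali.Hol E A F X, Tendsto (fun j => f (φ j)) atTop (𝓝 g)) ∨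
            ∃ W : Set A, IsOpen W ∧ Dense W ∧
              BanachVitali.CompactlyDivergentOn (fun j => ((f (φ j)).1 : A → X)) W) := by
  rw [BanachVitali.hyperbolic_iff_discEquicontinuous]
  exact ⟨fun h => ⟨h.discEquicontinuous, h.subsequenceAlternative⟩,
    fun h => BanachVitali.SubsequenceAlternative.wvp h.2 h.1⟩
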